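/- **Setting.** Let $1\le K\le N$, let $\mathcal S$ be the collection of all $S\subseteq\{1,\dots,N\}$ with $1\le |S|\le K$, and let $\Delta(\mathcal S)$ be the set of probability distributions on $\mathcal S$. For $S\in\mathcal S$ and $v\in[0,1]^N$ let $\mu(S,v)$ be the multinomial logit distribution on $\{0,1,\dots,N\}$: $\mu_i(S,v)=\frac{v_i}{1+\sum_{j\in S}v_j}$ for $i\in S$, $\mu_0(S,v)=\frac1{1+\sum_{j\in S}v_j}$, and $\mu_i(S,v)=0$ otherwise. For $r\in[0,1]^N$ let $R(S,v,r)=\sum_{i\in S}\mu_i(S,v)r_i$. For $\rho\in\Delta(\mathcal S)$ let $w_i(\rho)=\sum_{S\ni i}\rho(S)$. Let $\mathcal X$ be a measurable space, $\mathcal D$ a probability distribution on $\mathcal X\times[0,1]^N$, and $\mathcal F$ a class of functions $\mathcal X\to[0,1]^N$ that contains the unknown measurable function $f^\star$ (realizability). In each round $t=1,\dots,T$ a pair $(x_t,r_t)\sim\mathcal D$ is drawn independently of the past, the learner observes it and chooses $S_t\in\mathcal S$, and then observes the purchase decision $i_t\sim\mu(S_t,f^\star(x_t))$. The regret is $$\mathrm{Reg}_{\mathrm{MNL}}=\mathbb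 E\Big[\sum_{t=1}^T\Big(\max_{S\in\mathcal S}R(S,f^\star(x_t),r_t)-R(S_t,f^\star(x_t),r_t)\Big)\Big].$$ **Oracle.** An offline regression oracle maps every finite data set $D$ of triples $(x,S,i)\in\mathcal X\times\mathcal S\times\{0,\dots,N\}$ to a function $\widehat f_D\in\mathcal F$, with $(D,x)\mapsto\widehat f_D(x)$ measurable for each size of $D$. It has generalization error $\mathrm{Err}_{\log}(n,\delta)=\mathrm{Err}_{\log}(n,\delta,\mathcal F)$, non-increasing in $n$, if for every $n\ge1$, every $\delta\in(0,1)$, every measurable true value function $f\in\mathcal F$ and every law $\mathcal H$ of $(x,S,i)$ under which $i$ given $(x,S)$ has distribution $\mu(S,f(x))$, a data set $D$ of $n$ i.i.d. samples from $\mathcal H$ satisfies, with probability at least $1-\delta$, $$\mathbb E_{(x,S,i)\sim\mathcal H}\big[-\log\mu_i(S,\widehat f_D(x))+\log\mu_i(S,f(x))\big]\le\mathrm{Err}_{\log}(n,\delta)\qquad(-\log 0=+\infty).$$ **Algorithm.** Let $\tau_0=0$, $\tau_m=2^{m-1}-1$ for $m\ge1$, and let $\gamma_1,\gamma_2,\dots>0$.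 At the beginning of epoch $m=1,2,\dots$, which consists of the rounds $\tau_m+1,\dots,\tau_{m+1}$, the samples $(x_t,S_t,i_t)$ with $\tau_{m-1}<t\le\tau_m$ are given to the oracle, which returns $f_m$. In each round $t$ of epoch $m$ the learner draws $S_t\sim q_m(x_t,r_t)$, where $q_m(x,r)$ (measurable in the data and in $(x,r)$) is a maximizer $$q_m(x,r)\in\operatorname*{argmax}_{\rho\in\Delta(\mathcal S)}\ \mathbb E_{S\sim\rho}\big[R(S,f_m(x),r)\big]-\frac{(K+1)^4}{\gamma_m}\sum_{i=1}^N\log\frac1{w_i(\rho)} .$$ **Theorem.** There is an absolute constant $C>0$ such that for all $1\le K\le N$, all $T\ge2$ and every error function $\mathrm{Err}_{\log}$ with $\mathrm{Err}_{\log}(1,1/T^2)>0$, there is a choice of positive parameters $\gamma_1,\gamma_2,\dots$, depending only on $N,K,T$ and $\mathrm{Err}_{\log}$, for which the following holds. For every $\mathcal X$, every $\mathcal F$, every offline regression oracle for $\mathcal F$ with generalization error $\mathrm{Err}_{\log}$, every $f^\star\in\mathcal F$ and every $\mathcal D$ as above, the algorithm satisfies $$\mathrm{Reg}_{\mathrm{MNL}}\le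 C\sum_{m=1}^{\lceil\log_2T\rceil}2^mK^2\sqrt{N\,\mathrm{Err}_{\log}(2^{m-1},1/T^2)} .$$ -/

import Mathlib

open MeasureTheory ProbabilityTheory

noncomputable section

namespace MNLBandit

/-! ### The multinomial logit (MNL) choice model -/

/-- Vectors in `[0,1]^N`, used both for item values and for item rewards. -/
abbrev Vec (N : ℕ) : Type := Fin N → unitInterval

/-- The collection `𝒮` of all sets of items with at least `1` and at most `K` elements. -/
abbrev Assortment (N K : ℕ) : Type := {S : Finset (Fin N) // 1 ≤ S.card ∧ S.card ≤ K}

/-- The set `[N]₀` of purchase decisions: `none` is the no-purchase option `0`. -/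
abbrev Choice (N : ℕ) : Type := Option (Fin N)

instance (N : ℕ) : MeasurableSpace (Option (Fin N)) := ⊤

instance (N : ℕ) : DiscreteMeasurableSpace (Option (Fin N)) := ⟨fun _ => trivial⟩

/-- `μ_i(S, v)`, the probability that the customer chooses `i` from `S` when the item values are
`v` (the value of the no-purchase option being `1`). -/
def mnlProb {N K : ℕ} (S : Assortment N K) (v : Vec N) : Choice N → ℝ
  | none => 1 / (1 + ∑ j ∈ S.1, (v j : ℝ))
  | some i => if i ∈ S.1 then (v i : ℝ) / (1 + ∑ j ∈ S.1, (v j : ℝ)) else 0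

/-- `R(S, v, r)`, the expected reward of assortment `S` under values `v` and rewards `r`. -/
def expReward {N K : ℕ} (S : Assortment N K) (v r : Vec N) : ℝ :=
  ∑ i ∈ S.1, mnlProb S v (some i) * (r i : ℝ)

/-- `μ(S, v)` as a measure on `[N]₀`. -/
def mnlMeasure {N K : ℕ} (S : Assortment N K) (v : Vec N) : Measure (Choice N) :=
  ∑ i : Choice N, ENNReal.ofReal (mnlProb S v i) • Measure.dirac i

lemma mnlProb_nonneg {N K : ℕ} (S : Assortment N K) (v : Vec N) (i : Choice N) :
    0 ≤ mnlProb S v i := by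
  have h : 0 ≤ ∑ j ∈ S.1, (v j : ℝ) := Finset.sum_nonneg fun j _ => (v j).2.1
  cases i with
  | none => simp only [mnlProb]; positivity
  | some i =>
    simp only [mnlProb]
    split_ifs
    · exact div_nonneg (v i).2.1 (by positivity)
    · exact le_rfl

lemma sum_mnlProb {N K : ℕ} (S : Assortment N K) (v : Vec N) :
    ∑ i : Choice N, mnlProb S v i = 1 := by
  have h : 0 ≤ ∑ j ∈ S.1, (v j : ℝ) := Finset.sum_nonneg fun j _ => (v j).2.1
  rw [Fintype.sum_option]
  simp only [mnlProb]
  rw [Finset.sum_ite_mem, Finset.univ_inter, ← Finset.sum_div, ← add_div]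
  exact div_self (by positivity)

instance {N K : ℕ} (S : Assortment N K) (v : Vec N) : IsProbabilityMeasure (mnlMeasure S v) := by
  constructor
  simp only [mnlMeasure, Measure.coe_finsetSum, Finset.sum_apply, Measure.smul_apply,
    measure_univ, smul_eq_mul, mul_one]
  rw [← ENNReal.ofReal_sum_of_nonneg fun i _ => mnlProb_nonneg S v i, sum_mnlProb]
  simp

lemma measurable_mnlProb {X : Type*} [MeasurableSpace X] {N K : ℕ} {f : X → Vec N}
    (hf : Measurable f) (i : Choice N) :
    Measurable fun p : X × Assortment N K => mnlProb p.2 (f p.1) i := by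
  apply measurable_from_prod_countable_left
  intro S
  cases i with
  | none => simp only [mnlProb]; fun_prop
  | some i => simp only [mnlProb]; split_ifs <;> fun_prop

/-- The customer: given a context `x` and an assortment `S`, the purchase decision has
distribution `μ(S, f x)`. -/
def mnlKernel {X : Type*} [MeasurableSpace X] {N : ℕ} (K : ℕ) (f : X → Vec N)
    (hf : Measurable f) : Kernel (X × Assortment N K) (Choice N) where
  toFun p := mnlMeasure p.2 (f p.1)
  measurable' := by
    refine Measure.measurable_of_measurable_coe _ fun s _ => ?_
    simp only [mnlMeasure, Measure.coe_finsetSum, Finset.sum_apply, Measure.smul_apply,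
      smul_eq_mul]
    exact Finset.measurable_sum _ fun i _ =>
      (measurable_mnlProb hf i).ennreal_ofReal.mul_const _

instance {X : Type*} [MeasurableSpace X] {N K : ℕ} (f : X → Vec N) (hf : Measurable f) :
    IsMarkovKernel (mnlKernel K f hf) :=
  ⟨fun p => inferInstanceAs (IsProbabilityMeasure (mnlMeasure p.2 (f p.1)))⟩

/-! ### Offline log-loss regression -/

/-- A context-assortment-purchase tuple. -/
abbrev Sample (X : Type*) (N K : ℕ) : Type _ := (X × Assortment N K) × Choice N

abbrev Dataset (X : Type*) (N K n : ℕ) : Type _ := Fin n → Sample X N K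

/-- The log loss `-log p` of an outcome that was predicted with probability `p ∈ [0,1]`; it is
infinite at `p = 0`. -/
def logLoss (p : ℝ) : ENNReal := if 0 < p then ENNReal.ofReal (-Real.log p) else ⊤

/-- The expected log loss of the value predictor `f` on a sample with law `H`. -/
def expLogLoss {X : Type*} [MeasurableSpace X] {N K : ℕ} (H : Measure (Sample X N K))
    (f : X → Vec N) : ENNReal :=
  ∫⁻ z, logLoss (mnlProb z.1.2 (f z.1.1) z.2) ∂H

/-- The expected log loss of `g` in excess of that of `f`. It is only used when `f` generates the
choices under `H`; then the subtracted term is finite, being at most `log (K + 1)`. -/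
def excessLogLoss {X : Type*} [MeasurableSpace X] {N K : ℕ} (H : Measure (Sample X N K))
    (g f : X → Vec N) : EReal :=
  (expLogLoss H g : EReal) - (expLogLoss H f : EReal)

/-- A map from data sets of any size to value predictors. -/
abbrev OracleMap (X : Type*) (N K : ℕ) : Type _ :=
  (n : ℕ) → Dataset X N K n → X → Vec N

/-- `A` is an offline regression oracle for the class `F` with generalization error `Err`:
whatever the true value function `f ∈ F` and the law `G` of the pairs (context, assortment), given
`n` i.i.d. samples it outputs, with probability at least `1 - δ`, a member of `F` whose excess
log loss is at most `Err n δ`. -/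
structure IsOfflineOracle {X : Type*} [MeasurableSpace X] {N K : ℕ} (F : Set (X → Vec N))
    (A : OracleMap X N K) (Err : ℕ → ℝ → ℝ) : Prop where
  measurable : ∀ n, Measurable fun p : Dataset X N K n × X => A n p.1 p.2
  mem : ∀ n (data : Dataset X N K n), A n data ∈ F
  antitone : ∀ δ ∈ Set.Ioo (0 : ℝ) 1, ∀ n n' : ℕ, 1 ≤ n → n ≤ n' → Err n' δ ≤ Err n δ
  gen_error : ∀ n : ℕ, 1 ≤ n → ∀ δ ∈ Set.Ioo (0 : ℝ) 1,
    ∀ f ∈ F, ∀ hf : Measurable f,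
    ∀ G : Measure (X × Assortment N K), IsProbabilityMeasure G →
      ENNReal.ofReal (1 - δ) ≤
        Measure.pi (fun _ : Fin n => G ⊗ₘ mnlKernel K f hf)
          {data | excessLogLoss (G ⊗ₘ mnlKernel K f hf) (A n data) f ≤ (Err n δ : EReal)}

/-! ### The log-barrier regularized policy -/

/-- `w_i(ρ)`, the probability that item `i` is selected under `ρ`. -/
def itemProb {N K : ℕ} (ρ : Assortment N K → ℝ) (i : Fin N) : ℝ :=
  ∑ S : Assortment N K, if i ∈ S.1 then ρ S else 0

open Classical in
/-- `𝔼_{S ∼ ρ}[R(S, v, r)] - (K+1)⁴ / γ * ∑ i, log (1 / w_i(ρ))`, with value `-∞` if some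
`w_i(ρ)` vanishes. -/
def barrierObjective {N K : ℕ} (v r : Vec N) (γ : ℝ) (ρ : Assortment N K → ℝ) : EReal :=
  if ∀ i, 0 < itemProb ρ i then
    ((∑ S, ρ S * expReward S v r
      - ((K : ℝ) + 1) ^ 4 / γ * ∑ i, Real.log (1 / itemProb ρ i) : ℝ) : EReal)
  else ⊥

/-- `ρ ∈ Δ(𝒮)` maximizes the log-barrier regularized objective over `Δ(𝒮)`. -/
def IsBarrierOptimal {N K : ℕ} (v r : Vec N) (γ : ℝ) (ρ : Assortment N K → ℝ) : Prop :=
  ρ ∈ stdSimplex ℝ (Assortment N K) ∧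
    IsMaxOn (barrierObjective v r γ) (stdSimplex ℝ (Assortment N K)) ρ

/-! ### The epoch-based algorithm

Rounds are numbered from `0`, so that epoch `m ≥ 1` consists of the rounds `t` with
`τ m ≤ t < τ (m + 1)`. -/

/-- The epoch schedule: `τ 0 = 0` and `τ m = 2 ^ (m - 1) - 1` for `m ≥ 1`. -/
def τ (m : ℕ) : ℕ := 2 ^ (m - 1) - 1

/-- The number of samples that the oracle receives at the beginning of epoch `m`. -/
abbrev epochSize (m : ℕ) : ℕ := τ m - τ (m - 1)

/-- The record `((x, r), S, i)` of one round. -/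
abbrev Round (X : Type*) (N K : ℕ) : Type _ := (X × Vec N) × Assortment N K × Choice N

/-- A family of stochastic policies: in epoch `m`, after the oracle received the samples of
epoch `m - 1`, the kernel `q m` maps these samples and the observed pair (context, reward vector)
to a distribution over assortments. -/
abbrev PolicyFamily (X : Type*) [MeasurableSpace X] (N K : ℕ) : Type _ :=
  (m : ℕ) → Kernel (Dataset X N K (epochSize m) × (X × Vec N)) (Assortment N K)

/-- In every epoch `m ≥ 1` the policy solves the log-barrier problem with parameter `γ m` for the
value function `f_m` that the oracle `A` returned on the samples of epoch `m - 1`. -/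
structure IsBarrierPolicy {X : Type*} [MeasurableSpace X] {N K : ℕ} (A : OracleMap X N K)
    (γ : ℕ → ℝ) (q : PolicyFamily X N K) : Prop where
  markov : ∀ m, IsMarkovKernel (q m)
  optimal : ∀ m, 1 ≤ m → ∀ (data : Dataset X N K (epochSize m)) (x : X) (r : Vec N),
    IsBarrierOptimal (A (epochSize m) data x) r (γ m)
      fun S => (q m (data, (x, r))).real {S}

/-- The samples of the rounds `τ (m - 1) ≤ t < τ m`, read off a history of `t ≥ τ m` rounds. -/
def epochData {X : Type*} {N K : ℕ} (m t : ℕ) (h : τ m ≤ t) (hist : Fin t → Round X N K) :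
    Dataset X N K (epochSize m) :=
  fun k =>
    let z := hist ⟨τ (m - 1) + k, by have := k.2; simp only [epochSize] at this; omega⟩
    ((z.1.1, z.2.1), z.2.2)

lemma measurable_epochData {X : Type*} [MeasurableSpace X] {N K : ℕ} (m t : ℕ) (h : τ m ≤ t) :
    Measurable (epochData (X := X) (N := N) (K := K) m t h) := by
  unfold epochData
  fun_prop

/-- The records of the rounds before round `t`. -/
def past {Ω X : Type*} {N K : ℕ} (Z : ℕ → Ω → Round X N K) (t : ℕ) (ω : Ω) :
    Fin t → Round X N K :=
  fun s => Z s ω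

/-- `Z t` (for `t < T`) is the record of round `t` of the interaction between the algorithm that
plays the policies `q` and a stochastic environment: given the past, `(x_t, r_t)` has law `D`;
given the past and `(x_t, r_t)`, the assortment `S_t` has law `q_m(x_t, r_t)`, where `m` is the
current epoch; given all this, the purchase decision `i_t` has law `μ(S_t, f x_t)`. -/
structure IsInteraction {Ω X : Type*} [MeasurableSpace Ω] [MeasurableSpace X] {N K : ℕ}
    (P : Measure Ω) (Z : ℕ → Ω → Round X N K) (D : Measure (X × Vec N))
    (q : PolicyFamily X N K) (f : X → Vec N) (hf : Measurable f) (T : ℕ) : Prop where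
  context : ∀ t < T,
    HasCondDistrib (fun ω => (Z t ω).1) (past Z t) (Kernel.const _ D) P
  assortment : ∀ t < T, ∀ m, ∀ h : τ m ≤ t, t < τ (m + 1) →
    HasCondDistrib (fun ω => (Z t ω).2.1) (fun ω => (past Z t ω, (Z t ω).1))
      ((q m).comap (Prod.map (epochData m t h) id)
        ((measurable_epochData m t h).prodMap measurable_id)) P
  choice : ∀ t < T,
    HasCondDistrib (fun ω => (Z t ω).2.2)
      (fun ω => ((past Z t ω, (Z t ω).1), (Z t ω).2.1))
      ((mnlKernel K f hf).comap (fun p => (p.1.2.1, p.2)) (by fun_prop)) P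

/-- The expected regret over `T` rounds when the true value function is `f`. -/
def regret {Ω X : Type*} [MeasurableSpace Ω] {N K : ℕ} (P : Measure Ω)
    (Z : ℕ → Ω → Round X N K) (f : X → Vec N) (T : ℕ) : ℝ :=
  ∫ ω, ∑ t ∈ Finset.range T,
    ((⨆ S : Assortment N K, expReward S (f (Z t ω).1.1) (Z t ω).1.2)
      - expReward (Z t ω).2.1 (f (Z t ω).1.1) (Z t ω).1.2) ∂P

end MNLBandit

end

/-!
The regret of the log-barrier policies is analysed pointwise, in a fixed context `(x, r)`, and the
result is integrated only at the end.

*Pointwise.* Let `w i` be the selection probabilities of the policy `ρ` of epoch `m`, computed from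
the estimate `f_m`. First-order optimality of the barrier problem
(`IsBarrierOptimal.first_order`) says that the estimated regret of `ρ` is at most
`N (K + 1)⁴ / γ m`, and that for every assortment `S` the sum `∑ i ∈ S, 1 / w i` is bounded by `N`
plus the estimated regret of `S`, scaled by `γ m / (K + 1)⁴`. The expected reward is Lipschitz in
the values, so by the weighted AM-GM inequality the error of the next reward estimate of *any* `S`
is at most a fraction of the regret of `S` estimated in epoch `m`, plus a term `N (K + 1)⁴ / γ`,
plus a multiple of the squared error of `f_(m+1)` on assortments drawn from `ρ`
(`IsBarrierOptimal.mul_abs_expReward_sub_le`). By induction over the epochs, true and estimated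
regrets are equivalent up to an additive term in which the squared errors of the past epochs are
discounted geometrically (`mul_regret_le_accumError`).

*Expectation.* Given the data from which its policy was computed, the samples of an epoch are
i.i.d. (`IsInteraction.lintegral_epochSamples`). On the success event of the oracle, the excess
log loss, a Kullback-Leibler divergence, dominates the squared error
(`lintegral_choiceSqDist_le`, `sum_sq_sub_le_choiceSqDist`). The failure event cannot be paid for
by the trivial bound `1` on the regret, because `Err 1 δ` may be much smaller than `1 / T`.
Instead, an oracle with a small error on a *single* sample forces all members of the class to be
uniformly close: it has to answer the data set "only item `i` was offered in the context `x`, and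
nothing was bought", which has probability at least `1 / 2` under all of them, accurately for each
of them (`IsOfflineOracle.sq_sub_le`). This also bounds the regret of epoch `1`, which has no data.

The parameters `γ m` (`barrierParam`) balance the two error terms. They use the maximum of
`Err (2 ^ (m - 2)) δ` and `Err 1 δ * δ` with `δ = 1 / T ^ 2`; the second term accounts for the
failure event, keeps `γ m` finite when the first one is not positive, and costs only
`√(N * Err 1 δ)` in the sum over all rounds.
-/

namespace MNLBandit

/-! ### Elementary bounds for the multinomial logit model -/

section MNL

variable {N K : ℕ}

lemma mnlProb_le_one (S : Assortment N K) (v : Vec N) (i : Choice N) : mnlProb S v i ≤ 1 := by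
  rw [← sum_mnlProb S v]
  exact Finset.single_le_sum (fun j _ => mnlProb_nonneg S v j) (Finset.mem_univ i)

lemma expReward_eq_div (S : Assortment N K) (v r : Vec N) :
    expReward S v r = (∑ i ∈ S.1, (v i : ℝ) * r i) / (1 + ∑ j ∈ S.1, (v j : ℝ)) := by
  rw [expReward, Finset.sum_div]
  refine Finset.sum_congr rfl fun i hi => ?_
  simp only [mnlProb, if_pos hi]
  ring

lemma expReward_nonneg (S : Assortment N K) (v r : Vec N) : 0 ≤ expReward S v r :=
  Finset.sum_nonneg fun i _ => mul_nonneg (mnlProb_nonneg S v _) (r i).2.1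

lemma expReward_le_one (S : Assortment N K) (v r : Vec N) : expReward S v r ≤ 1 := by
  have h : 0 ≤ ∑ j ∈ S.1, (v j : ℝ) := Finset.sum_nonneg fun j _ => (v j).2.1
  rw [expReward_eq_div, div_le_one (by positivity)]
  have : ∑ i ∈ S.1, (v i : ℝ) * r i ≤ ∑ j ∈ S.1, (v j : ℝ) :=
    Finset.sum_le_sum fun i _ => mul_le_of_le_one_right (v i).2.1 (r i).2.2
  linarith

/-- The expected reward is `1`-Lipschitz in the item values of the assortment for the `ℓ¹` norm:
`R(S, v, r) - R(S, v', r) = ∑ i ∈ S, (v i - v' i) (r i - R(S, v', r)) / (1 + ∑ j ∈ S, v j)`. -/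
lemma abs_expReward_sub_le (S : Assortment N K) (v v' r : Vec N) :
    |expReward S v r - expReward S v' r| ≤ ∑ i ∈ S.1, |(v i : ℝ) - v' i| := by
  have h : 0 ≤ ∑ j ∈ S.1, (v j : ℝ) := Finset.sum_nonneg fun j _ => (v j).2.1
  have h' : 0 ≤ ∑ j ∈ S.1, (v' j : ℝ) := Finset.sum_nonneg fun j _ => (v' j).2.1
  have key : expReward S v r - expReward S v' r =
      (∑ i ∈ S.1, ((v i : ℝ) - v' i) * (r i - expReward S v' r))
        / (1 + ∑ j ∈ S.1, (v j : ℝ)) := by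
    have e : ∑ i ∈ S.1, ((v i : ℝ) - v' i) * (r i - expReward S v' r) =
        (∑ i ∈ S.1, (v i : ℝ) * r i) - (∑ i ∈ S.1, (v' i : ℝ) * r i)
          - (∑ j ∈ S.1, (v j : ℝ) - ∑ j ∈ S.1, (v' j : ℝ)) * expReward S v' r := by
      rw [← Finset.sum_sub_distrib, ← Finset.sum_sub_distrib, Finset.sum_mul,
        ← Finset.sum_sub_distrib]
      exact Finset.sum_congr rfl fun i _ => by ring
    rw [e, expReward_eq_div S v r, expReward_eq_div S v' r]
    field_simp
    ring
  rw [key, abs_div, abs_of_nonneg (by positivity : 0 ≤ 1 + ∑ j ∈ S.1, (v j : ℝ))]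
  refine (div_le_self (abs_nonneg _) (by linarith)).trans ?_
  refine (Finset.abs_sum_le_sum_abs _ _).trans (Finset.sum_le_sum fun i _ => ?_)
  rw [abs_mul]
  refine mul_le_of_le_one_right (abs_nonneg _) ?_
  have h1 := (r i).2
  have h2 := expReward_nonneg S v' r
  have h3 := expReward_le_one S v' r
  rw [abs_le]
  constructor <;> linarith [h1.1, h1.2]

/-- The values of the offered items are recovered from the choice probabilities as
`v i = μ i / μ 0`, with `1 / μ 0 ≤ |S| + 1`; hence they are stable under perturbations of the
choice probabilities. -/
lemma sum_sq_sub_le_sum_mnlProb (S : Assortment N K) (v v' : Vec N) :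
    ∑ i ∈ S.1, ((v i : ℝ) - v' i) ^ 2 ≤
      2 * ((S.1.card : ℝ) + 1) ^ 3 *
        ∑ y : Choice N, (mnlProb S v y - mnlProb S v' y) ^ 2 := by
  have h : 0 ≤ ∑ j ∈ S.1, (v j : ℝ) := Finset.sum_nonneg fun j _ => (v j).2.1
  have h' : 0 ≤ ∑ j ∈ S.1, (v' j : ℝ) := Finset.sum_nonneg fun j _ => (v' j).2.1
  have hD : 1 + ∑ j ∈ S.1, (v j : ℝ) ≤ (S.1.card : ℝ) + 1 := by
    have : ∑ j ∈ S.1, (v j : ℝ) ≤ ∑ _j ∈ S.1, (1 : ℝ) :=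
      Finset.sum_le_sum fun i _ => (v i).2.2
    simp at this
    linarith
  have hD0 : 0 ≤ 1 + ∑ j ∈ S.1, (v j : ℝ) := by positivity
  have hterm : ∀ i ∈ S.1, ((v i : ℝ) - v' i) ^ 2 ≤ 2 * ((S.1.card : ℝ) + 1) ^ 2 *
      ((mnlProb S v (some i) - mnlProb S v' (some i)) ^ 2
        + (mnlProb S v none - mnlProb S v' none) ^ 2) := by
    intro i hi
    have e : (v i : ℝ) - v' i = (1 + ∑ j ∈ S.1, (v j : ℝ)) *
        ((mnlProb S v (some i) - mnlProb S v' (some i))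
          - v' i * (mnlProb S v none - mnlProb S v' none)) := by
      simp only [mnlProb, if_pos hi]
      field_simp
      ring
    rw [e, mul_pow]
    generalize mnlProb S v (some i) - mnlProb S v' (some i) = a
    generalize mnlProb S v none - mnlProb S v' none = b
    have h1 : (a - v' i * b) ^ 2 ≤ 2 * (a ^ 2 + b ^ 2) := by
      have h2 : ((v' i : ℝ) * b) ^ 2 ≤ b ^ 2 := by
        rw [mul_pow]
        exact mul_le_of_le_one_left (sq_nonneg _) (pow_le_one₀ (v' i).2.1 (v' i).2.2)
      nlinarith [sq_nonneg (a + v' i * b)]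
    calc (1 + ∑ j ∈ S.1, (v j : ℝ)) ^ 2 * (a - v' i * b) ^ 2
        ≤ ((S.1.card : ℝ) + 1) ^ 2 * (2 * (a ^ 2 + b ^ 2)) := by gcongr
      _ = _ := by ring
  refine (Finset.sum_le_sum hterm).trans ?_
  rw [← Finset.mul_sum, Finset.sum_add_distrib, Finset.sum_const, nsmul_eq_mul,
    Fintype.sum_option]
  have h1 : ∑ i ∈ S.1, (mnlProb S v (some i) - mnlProb S v' (some i)) ^ 2 ≤
      ∑ i, (mnlProb S v (some i) - mnlProb S v' (some i)) ^ 2 :=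
    Finset.sum_le_univ_sum_of_nonneg fun i => sq_nonneg _
  have h2 : (0 : ℝ) ≤ ∑ i ∈ S.1, (mnlProb S v (some i) - mnlProb S v' (some i)) ^ 2 :=
    Finset.sum_nonneg fun i _ => sq_nonneg _
  have hb : 0 ≤ (mnlProb S v none - mnlProb S v' none) ^ 2 := sq_nonneg _
  generalize (mnlProb S v none - mnlProb S v' none) ^ 2 = b at *
  generalize ∑ i ∈ S.1, (mnlProb S v (some i) - mnlProb S v' (some i)) ^ 2 = a at *
  generalize ∑ i, (mnlProb S v (some i) - mnlProb S v' (some i)) ^ 2 = a' at *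
  have hs : (0 : ℝ) ≤ S.1.card := by positivity
  generalize (S.1.card : ℝ) = s at *
  calc 2 * (s + 1) ^ 2 * (a + s * b) ≤ 2 * (s + 1) ^ 2 * ((s + 1) * (b + a')) := by
        gcongr
        nlinarith
    _ = _ := by ring

end MNL

/-! ### The log-barrier policy -/

section Barrier

variable {N K : ℕ}

lemma itemProb_nonneg {ρ : Assortment N K → ℝ} (hρ : ρ ∈ stdSimplex ℝ (Assortment N K))
    (i : Fin N) : 0 ≤ itemProb ρ i :=
  Finset.sum_nonneg fun S _ => by split_ifs <;> simp [hρ.1 S]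

lemma sum_itemProb_mul (ρ : Assortment N K → ℝ) (g : Fin N → ℝ) :
    ∑ i, itemProb ρ i * g i = ∑ S, ρ S * ∑ i ∈ S.1, g i := by
  simp only [itemProb, Finset.sum_mul, Finset.mul_sum]
  rw [Finset.sum_comm]
  refine Finset.sum_congr rfl fun S _ => ?_
  have h : ∑ i ∈ S.1, ρ S * g i = ∑ i, if i ∈ S.1 then ρ S * g i else 0 := by
    rw [Finset.sum_ite_mem, Finset.univ_inter]
  rw [h]
  exact Finset.sum_congr rfl fun i _ => by split_ifs <;> simp

lemma lineMap_mem_stdSimplex {ρ : Assortment N K → ℝ} (hρ : ρ ∈ stdSimplex ℝ (Assortment N K))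
    (S : Assortment N K) {ε : ℝ} (h0 : 0 ≤ ε) (h1 : ε ≤ 1) :
    (fun S' => (1 - ε) * ρ S' + ε * if S' = S then 1 else 0) ∈ stdSimplex ℝ (Assortment N K) := by
  refine ⟨fun S' => ?_, ?_⟩
  · have := hρ.1 S'
    have h2 : 0 ≤ 1 - ε := by linarith
    dsimp only
    split_ifs <;> positivity
  · rw [Finset.sum_add_distrib, ← Finset.mul_sum, ← Finset.mul_sum, hρ.2]
    simp

lemma itemProb_lineMap (ρ : Assortment N K → ℝ) (S : Assortment N K) (ε : ℝ) (i : Fin N) :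
    itemProb (fun S' => (1 - ε) * ρ S' + ε * if S' = S then 1 else 0) i =
      (1 - ε) * itemProb ρ i + ε * if i ∈ S.1 then 1 else 0 := by
  simp only [itemProb, Finset.mul_sum]
  have : (ε * if i ∈ S.1 then (1 : ℝ) else 0) =
      ∑ S' : Assortment N K, if S' = S then (ε * if i ∈ S.1 then (1 : ℝ) else 0) else 0 := by
    simp
  rw [this, ← Finset.sum_add_distrib]
  refine Finset.sum_congr rfl fun S' _ => ?_
  by_cases h : S' = S
  · subst h; split_ifs <;> simp
  · split_ifs <;> simp

/-- A maximizer of the barrier objective selects every item with positive probability. -/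
lemma IsBarrierOptimal.itemProb_pos (hK : 1 ≤ K) {v r : Vec N} {γ : ℝ} {ρ : Assortment N K → ℝ}
    (h : IsBarrierOptimal v r γ ρ) (i : Fin N) : 0 < itemProb ρ i := by
  by_contra hi
  let U : Assortment N K → ℝ := fun _ => (Fintype.card (Assortment N K) : ℝ)⁻¹
  have : Nonempty (Assortment N K) := ⟨⟨{i}, by simp, by simpa using hK⟩⟩
  have hc : 0 < (Fintype.card (Assortment N K) : ℝ)⁻¹ := by
    have := Fintype.card_pos (α := Assortment N K)
    positivity
  have hU : U ∈ stdSimplex ℝ (Assortment N K) := by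
    refine ⟨fun _ => hc.le, ?_⟩
    simp only [U, Finset.sum_const, Finset.card_univ, nsmul_eq_mul]
    exact mul_inv_cancel₀ (inv_pos.1 hc).ne'
  have hUpos : ∀ j, 0 < itemProb U j := by
    intro j
    refine Finset.sum_pos' (fun S _ => by split_ifs <;> simp [U]) ?_
    exact ⟨⟨{j}, by simp, by simpa using hK⟩, Finset.mem_univ _, by simpa [U] using hc⟩
  have := h.2 hU
  simp only [Set.mem_ofPred_eq] at this
  rw [barrierObjective, barrierObjective, if_pos hUpos, if_neg fun h' => hi (h' i)] at this
  exact EReal.coe_ne_bot _ (le_bot_iff.1 this)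

/-- First-order optimality of the log-barrier policy `ρ`, in the direction of the point mass
at `S`. -/
lemma IsBarrierOptimal.first_order (hK : 1 ≤ K) {v r : Vec N} {γ : ℝ} (hγ : 0 < γ)
    {ρ : Assortment N K → ℝ} (h : IsBarrierOptimal v r γ ρ) (S : Assortment N K) :
    expReward S v r + ((K : ℝ) + 1) ^ 4 / γ * ∑ i ∈ S.1, (itemProb ρ i)⁻¹ ≤
      ∑ S', ρ S' * expReward S' v r + ((K : ℝ) + 1) ^ 4 / γ * N := by
  have hw := h.itemProb_pos hK
  set lam : ℝ := ((K : ℝ) + 1) ^ 4 / γ with hlam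
  have hlam0 : 0 < lam := by positivity
  set E : ℝ := ∑ S', ρ S' * expReward S' v r with hE
  set s : Fin N → ℝ := fun i => if i ∈ S.1 then 1 else 0 with hs
  set w' : ℝ → Fin N → ℝ := fun ε i => (1 - ε) * itemProb ρ i + ε * s i with hw'
  -- The objective does not increase along the segment; `log x ≥ 1 - 1 / x` makes this linear.
  have hstep : ∀ ε ∈ Set.Ioo (0 : ℝ) 1,
      expReward S v r - E + lam * ∑ i, (s i - itemProb ρ i) / w' ε i ≤ 0 := by
    intro ε hε
    have hpos : ∀ i, 0 < w' ε i := by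
      intro i
      have h1 : 0 < 1 - ε := by linarith [hε.2]
      have h2 : 0 ≤ s i := by simp only [hs]; split_ifs <;> simp
      have := hw i
      have := hε.1
      simp only [hw']
      positivity
    have hopt := h.2 (lineMap_mem_stdSimplex h.1 S hε.1.le hε.2.le)
    simp only [Set.mem_ofPred_eq] at hopt
    rw [barrierObjective, barrierObjective, if_pos hw,
      if_pos (by intro i; rw [itemProb_lineMap]; exact hpos i), EReal.coe_le_coe_iff] at hopt
    simp only [itemProb_lineMap] at hopt
    have hrew : ∑ S', ((1 - ε) * ρ S' + ε * if S' = S then 1 else 0) * expReward S' v r =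
        (1 - ε) * E + ε * expReward S v r := by
      simp only [add_mul, Finset.sum_add_distrib, hE, Finset.mul_sum, mul_assoc]
      simp
    rw [hrew] at hopt
    have hlog : ∑ i, ε * ((s i - itemProb ρ i) / w' ε i) ≤
        ∑ i, Real.log (1 / itemProb ρ i) - ∑ i, Real.log (1 / w' ε i) := by
      rw [← Finset.sum_sub_distrib]
      refine Finset.sum_le_sum fun i _ => ?_
      have h1 := Real.add_one_le_exp (Real.log (itemProb ρ i / w' ε i))
      rw [Real.exp_log (div_pos (hw i) (hpos i)), Real.log_div (hw i).ne' (hpos i).ne'] at h1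
      rw [one_div, one_div, Real.log_inv, Real.log_inv]
      have h2 : ε * ((s i - itemProb ρ i) / w' ε i) = 1 - itemProb ρ i / w' ε i := by
        have := (hpos i).ne'
        rw [eq_sub_iff_add_eq, ← mul_div_assoc, ← add_div, div_eq_one_iff_eq this]
        simp only [hw']
        ring
      linarith
    rw [← Finset.mul_sum] at hlog
    have h3 : ε * (expReward S v r - E + lam * ∑ i, (s i - itemProb ρ i) / w' ε i) ≤ 0 := by
      have h4 := mul_le_mul_of_nonneg_left hlog hlam0.le
      change _ - lam * ∑ i, Real.log (1 / w' ε i) ≤ _ at hopt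
      nlinarith
    by_contra hcon
    push Not at hcon
    nlinarith [mul_pos hε.1 hcon]
  have hlim : Filter.Tendsto
      (fun ε => expReward S v r - E + lam * ∑ i, (s i - itemProb ρ i) / w' ε i)
      (nhdsWithin 0 (Set.Ioi 0))
      (nhds (expReward S v r - E + lam * ∑ i, (s i - itemProb ρ i) / w' 0 i)) := by
    apply tendsto_nhdsWithin_of_tendsto_nhds
    refine tendsto_const_nhds.add (tendsto_const_nhds.mul (tendsto_finsetSum _ fun i _ => ?_))
    refine tendsto_const_nhds.div ?_ (by simp [hw', (hw i).ne'])
    have : Continuous fun ε => w' ε i := by simp only [hw']; fun_prop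
    exact this.tendsto 0
  have hle := le_of_tendsto hlim (Filter.eventually_of_mem (Ioo_mem_nhdsGT one_pos) hstep)
  have hsum : ∑ i, (s i - itemProb ρ i) / w' 0 i = ∑ i ∈ S.1, (itemProb ρ i)⁻¹ - N := by
    have : ∀ i, (s i - itemProb ρ i) / w' 0 i = (if i ∈ S.1 then (itemProb ρ i)⁻¹ else 0) - 1 := by
      intro i
      have := (hw i).ne'
      simp only [hw', hs, sub_zero, one_mul, zero_mul, add_zero, sub_div, div_self this]
      split_ifs <;> simp
    simp only [this, Finset.sum_sub_distrib, Finset.sum_ite_mem, Finset.univ_inter]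
    simp
  rw [hsum] at hle
  linarith

lemma expReward_le_iSup (S : Assortment N K) (v r : Vec N) :
    expReward S v r ≤ ⨆ S' : Assortment N K, expReward S' v r :=
  le_ciSup (f := fun S' : Assortment N K => expReward S' v r) (Set.finite_range _).bddAbove S

/-- The log-barrier policy loses at most `N (K + 1)⁴ / γ` against the best assortment for the
values it is computed from. -/
lemma IsBarrierOptimal.mul_sum_regret_le (hK : 1 ≤ K) (hN : K ≤ N) {v r : Vec N} {γ : ℝ}
    (hγ : 0 < γ) {ρ : Assortment N K → ℝ} (h : IsBarrierOptimal v r γ ρ) :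
    γ * ∑ S, ρ S * ((⨆ S' : Assortment N K, expReward S' v r) - expReward S v r) ≤
      ((K : ℝ) + 1) ^ 4 * N := by
  have : Nonempty (Assortment N K) := ⟨⟨{⟨0, by omega⟩}, by simp, by simpa using hK⟩⟩
  have h1 : (⨆ S' : Assortment N K, expReward S' v r) ≤
      ∑ S', ρ S' * expReward S' v r + ((K : ℝ) + 1) ^ 4 / γ * N := by
    refine ciSup_le fun S => le_trans ?_ (h.first_order hK hγ S)
    have : 0 ≤ ∑ i ∈ S.1, (itemProb ρ i)⁻¹ :=
      Finset.sum_nonneg fun i _ => (inv_pos.2 (h.itemProb_pos hK i)).le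
    have : 0 ≤ ((K : ℝ) + 1) ^ 4 / γ * ∑ i ∈ S.1, (itemProb ρ i)⁻¹ := by positivity
    linarith
  simp only [mul_sub, Finset.sum_sub_distrib, ← Finset.sum_mul, h.1.2, one_mul]
  calc γ * (⨆ S' : Assortment N K, expReward S' v r) - γ * ∑ S, ρ S * expReward S v r
      ≤ γ * (∑ S', ρ S' * expReward S' v r + ((K : ℝ) + 1) ^ 4 / γ * N)
        - γ * ∑ S, ρ S * expReward S v r := by gcongr
    _ = ((K : ℝ) + 1) ^ 4 * N := by field_simp; ring

/-- The log-barrier policy explores every assortment `S` in proportion to its estimated quality: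
the inverse selection probabilities of the items of `S` are controlled by the estimated regret
of `S`. -/
lemma IsBarrierOptimal.sum_inv_itemProb_le (hK : 1 ≤ K) {v r : Vec N} {γ : ℝ}
    (hγ : 0 < γ) {ρ : Assortment N K → ℝ} (h : IsBarrierOptimal v r γ ρ) (S : Assortment N K) :
    ((K : ℝ) + 1) ^ 4 * ∑ i ∈ S.1, (itemProb ρ i)⁻¹ ≤ ((K : ℝ) + 1) ^ 4 * N +
      γ * ((⨆ S' : Assortment N K, expReward S' v r) - expReward S v r) := by
  have h1 := h.first_order hK hγ S
  have h2 : ∑ S', ρ S' * expReward S' v r ≤ ⨆ S' : Assortment N K, expReward S' v r := by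
    calc ∑ S', ρ S' * expReward S' v r
        ≤ ∑ S', ρ S' * ⨆ S'' : Assortment N K, expReward S'' v r :=
          Finset.sum_le_sum fun S' _ =>
            mul_le_mul_of_nonneg_left (expReward_le_iSup S' v r) (h.1.1 S')
      _ = _ := by rw [← Finset.sum_mul, h.1.2, one_mul]
  have h3 := mul_le_mul_of_nonneg_left (h1.trans (add_le_add_left h2 _)) hγ.le
  have e1 : γ * (expReward S v r + ((K : ℝ) + 1) ^ 4 / γ * ∑ i ∈ S.1, (itemProb ρ i)⁻¹) =
      γ * expReward S v r + ((K : ℝ) + 1) ^ 4 * ∑ i ∈ S.1, (itemProb ρ i)⁻¹ := by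
    field_simp
  have e2 : γ * ((⨆ S' : Assortment N K, expReward S' v r) + ((K : ℝ) + 1) ^ 4 / γ * N) =
      γ * (⨆ S' : Assortment N K, expReward S' v r) + ((K : ℝ) + 1) ^ 4 * N := by
    field_simp
  rw [e1, e2] at h3
  linarith

/-- The squared estimation error of `v` on a random assortment drawn from `ρ`, when the true
values are `u`. -/
def sqError (ρ : Assortment N K → ℝ) (v u : Vec N) : ℝ :=
  ∑ S, ρ S * ∑ i ∈ S.1, ((v i : ℝ) - u i) ^ 2

/-- If new values `v'` are estimated from data collected with the log-barrier policy `ρ` for the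
values `v`, then the error of the new reward estimate of *any* assortment `S` is controlled by
the estimation error under `ρ` and the regret of `S` that was estimated before. -/
lemma IsBarrierOptimal.mul_abs_expReward_sub_le (hK : 1 ≤ K) {v r : Vec N} {γ : ℝ}
    (hγ : 0 < γ) {ρ : Assortment N K → ℝ} (h : IsBarrierOptimal v r γ ρ) (v' u : Vec N)
    {γ' : ℝ} (hγ' : 0 < γ') (S : Assortment N K) :
    γ' * |expReward S v' r - expReward S u r| ≤
      ((K : ℝ) + 1) ^ 4 * N / 8 + 2 * γ' ^ 2 / ((K : ℝ) + 1) ^ 4 * sqError ρ v' u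
        + γ / 8 * ((⨆ S' : Assortment N K, expReward S' v r) - expReward S v r) := by
  have hlam : 0 < ((K : ℝ) + 1) ^ 4 := by positivity
  have h1 := h.sum_inv_itemProb_le hK hγ S
  set lam := ((K : ℝ) + 1) ^ 4
  -- AM-GM, weighted such that the estimated regret of `S` receives the factor `γ / 8`.
  have hterm : ∀ i, γ' * |(v' i : ℝ) - u i| ≤ lam / 8 * (itemProb ρ i)⁻¹ +
      2 * γ' ^ 2 / lam * (itemProb ρ i * ((v' i : ℝ) - u i) ^ 2) := by
    intro i
    have hw := h.itemProb_pos hK i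
    rw [← sq_abs ((v' i : ℝ) - u i)]
    generalize |(v' i : ℝ) - u i| = d
    generalize itemProb ρ i = w at *
    have : lam / 8 * w⁻¹ + 2 * γ' ^ 2 / lam * (w * d ^ 2) - γ' * d =
        (lam - 4 * γ' * w * d) ^ 2 / (8 * lam * w) := by
      field_simp
      ring
    have : 0 ≤ (lam - 4 * γ' * w * d) ^ 2 / (8 * lam * w) := by positivity
    linarith
  have hsum : ∑ i ∈ S.1, itemProb ρ i * ((v' i : ℝ) - u i) ^ 2 ≤ sqError ρ v' u := by
    rw [sqError, ← sum_itemProb_mul]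
    exact Finset.sum_le_univ_sum_of_nonneg fun i =>
      mul_nonneg (itemProb_nonneg h.1 i) (sq_nonneg _)
  calc γ' * |expReward S v' r - expReward S u r|
      ≤ γ' * ∑ i ∈ S.1, |(v' i : ℝ) - u i| := by
        gcongr
        exact abs_expReward_sub_le S v' u r
    _ ≤ ∑ i ∈ S.1, (lam / 8 * (itemProb ρ i)⁻¹ +
          2 * γ' ^ 2 / lam * (itemProb ρ i * ((v' i : ℝ) - u i) ^ 2)) := by
        rw [Finset.mul_sum]
        exact Finset.sum_le_sum fun i _ => hterm i
    _ = (lam * ∑ i ∈ S.1, (itemProb ρ i)⁻¹) / 8 +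
          2 * γ' ^ 2 / lam * ∑ i ∈ S.1, itemProb ρ i * ((v' i : ℝ) - u i) ^ 2 := by
        rw [Finset.sum_add_distrib, ← Finset.mul_sum, ← Finset.mul_sum]
        ring
    _ ≤ (lam * N + γ * ((⨆ S' : Assortment N K, expReward S' v r) - expReward S v r)) / 8 +
          2 * γ' ^ 2 / lam * sqError ρ v' u := by gcongr
    _ = _ := by ring

end Barrier

/-! ### Propagation of the estimation errors over the epochs -/

/-- The accumulated effect on epoch `m` of the estimation errors `c 1, …, c m` of the epochs up
to `m`, namely `2 * ∑ k, c k / 4 ^ (m - k)`. -/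
noncomputable def accumError (c : ℕ → ℝ) : ℕ → ℝ
  | 0 => 0
  | m + 1 => accumError c m / 4 + 2 * c (m + 1)

lemma accumError_nonneg {c : ℕ → ℝ} (hc : ∀ m, 0 ≤ c m) : ∀ m, 0 ≤ accumError c m
  | 0 => le_rfl
  | m + 1 => by
    have := accumError_nonneg hc m
    have := hc (m + 1)
    rw [accumError]
    positivity

/-- A reward estimate `Rh` whose error on each `S` is at most a quarter of the true regret of `S`
plus a common constant has estimated regrets that are equivalent to the true ones `Rs`, up to
that constant. -/
lemma regret_equivalence {ι : Type*} [Finite ι] [Nonempty ι] {Rs Rh : ι → ℝ} {γ b : ℝ}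
    (hγ : 0 ≤ γ)
    (h : ∀ S, γ * |Rh S - Rs S| ≤ γ * ((⨆ S', Rs S') - Rs S) / 4 + b / 2) (S : ι) :
    γ * ((⨆ S', Rh S') - Rh S) ≤ 2 * (γ * ((⨆ S', Rs S') - Rs S)) + b ∧
      γ * ((⨆ S', Rs S') - Rs S) ≤ 4 / 3 * (γ * ((⨆ S', Rh S') - Rh S) + b) := by
  obtain ⟨Sh, hSh⟩ := exists_eq_ciSup_of_finite (f := Rh)
  obtain ⟨Ss, hSs⟩ := exists_eq_ciSup_of_finite (f := Rs)
  have hle : ∀ S, Rs S ≤ ⨆ S', Rs S' := le_ciSup (Set.finite_range _).bddAbove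
  have hle' : ∀ S, Rh S ≤ ⨆ S', Rh S' := le_ciSup (Set.finite_range _).bddAbove
  have habs : ∀ S, |γ * (Rh S - Rs S)| ≤ γ * ((⨆ S', Rs S') - Rs S) / 4 + b / 2 := by
    intro S
    rw [abs_mul, abs_of_nonneg hγ]
    exact h S
  have h1 := abs_le.1 (habs S)
  have h2 := abs_le.1 (habs Sh)
  have h3 := abs_le.1 (habs Ss)
  have g1 := mul_le_mul_of_nonneg_left (hle S) hγ
  have g2 := mul_le_mul_of_nonneg_left (hle Sh) hγ
  have g3 := mul_le_mul_of_nonneg_left (hle' Ss) hγ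
  rw [hSh] at h2
  rw [hSs] at h3
  simp only [mul_sub] at *
  constructor <;> linarith

/-- If the error of the reward estimate of epoch `m + 1` on each `S` is controlled by the regret
of `S` estimated in epoch `m`, then the estimated and the true regrets are equivalent in all
epochs. -/
lemma mul_regret_le_accumError {ι : Type*} [Finite ι] [Nonempty ι] {Rs : ι → ℝ}
    {Rh : ℕ → ι → ℝ} {γ c : ℕ → ℝ} (hγ : ∀ m, 0 < γ m) (hmono : ∀ m, 1 ≤ m → γ m ≤ γ (m + 1))
    (M : ℕ)
    (h1 : ∀ S, γ 1 * |Rh 1 S - Rs S| ≤ c 1)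
    (hstep : ∀ m, 1 ≤ m → m < M → ∀ S, γ (m + 1) * |Rh (m + 1) S - Rs S| ≤
      c (m + 1) + γ m / 8 * ((⨆ S', Rh m S') - Rh m S)) (m : ℕ) (hm : 1 ≤ m) (hmM : m ≤ M)
    (S : ι) :
    γ m * ((⨆ S', Rs S') - Rs S) ≤
      4 / 3 * (γ m * ((⨆ S', Rh m S') - Rh m S) + accumError c m) := by
  have hle : ∀ S, Rs S ≤ ⨆ S', Rs S' := le_ciSup (Set.finite_range _).bddAbove
  suffices ∀ S, γ m * |Rh m S - Rs S| ≤
      γ m * ((⨆ S', Rs S') - Rs S) / 4 + accumError c m / 2 from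
    (regret_equivalence (hγ m).le this S).2
  induction m, hm using Nat.le_induction with
  | base =>
    intro S
    have g := mul_le_mul_of_nonneg_left (hle S) (hγ 1).le
    have := h1 S
    simp only [accumError]
    linarith
  | succ m hm ih =>
    intro S
    have g1 := (regret_equivalence (hγ m).le (ih (by omega)) S).1
    have g2 := hstep m hm (by omega) S
    have g3 := mul_le_mul_of_nonneg_right (hmono m hm) (sub_nonneg.2 (hle S))
    simp only [accumError]
    linarith

/-! ### From the log loss to the squared error -/

lemma measurable_logLoss : Measurable logLoss := by
  unfold logLoss
  exact Measurable.ite measurableSet_Ioi (by fun_prop) measurable_const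

/-- Up to the terms `p - q`, the Kullback-Leibler divergence dominates the squared Hellinger
distance term by term, and `(p - q) ^ 2 ≤ 4 * (√p - √q) ^ 2`. -/
lemma sq_sub_div_four_le {p q : ℝ} (hp0 : 0 ≤ p) (hp1 : p ≤ 1) (hq0 : 0 ≤ q) (hq1 : q ≤ 1)
    (hpq : 0 < q ∨ p = 0) :
    (p - q) ^ 2 / 4 + (p - q) + p * -Real.log p ≤ p * -Real.log q := by
  rcases hp0.eq_or_lt with rfl | hp
  · nlinarith
  have hq : 0 < q := hpq.resolve_right hp.ne'
  obtain ⟨a, ha, rfl⟩ : ∃ a : ℝ, 0 < a ∧ a ^ 2 = p := ⟨√p, by positivity, Real.sq_sqrt hp0⟩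
  obtain ⟨b, hb, rfl⟩ : ∃ b : ℝ, 0 < b ∧ b ^ 2 = q := ⟨√q, by positivity, Real.sq_sqrt hq0⟩
  have ha1 : a ≤ 1 := by nlinarith
  have hb1 : b ≤ 1 := by nlinarith
  have h1 := Real.log_le_sub_one_of_pos (div_pos hb ha)
  rw [Real.log_div hb.ne' ha.ne'] at h1
  rw [Real.log_pow, Real.log_pow]
  have h2 : a ^ 2 * (Real.log b - Real.log a) ≤ a * b - a ^ 2 := by
    calc a ^ 2 * (Real.log b - Real.log a) ≤ a ^ 2 * (b / a - 1) := by gcongr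
      _ = _ := by field_simp
  have h3 : (a ^ 2 - b ^ 2) ^ 2 ≤ 4 * (a - b) ^ 2 := by
    have : (a ^ 2 - b ^ 2) ^ 2 = (a + b) ^ 2 * (a - b) ^ 2 := by ring
    rw [this]
    have : (a + b) ^ 2 ≤ 4 := by nlinarith
    gcongr
  push_cast
  nlinarith

lemma coe_ennreal_le_sub {a b c : ENNReal} (hb : b ≠ ⊤) (h : a + b ≤ c) :
    (a : EReal) ≤ (c : EReal) - (b : EReal) := by
  refine (EReal.le_sub_iff_add_le (Or.inl (EReal.coe_ennreal_ne_bot b))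
    (Or.inl (by simpa using hb))).2 ?_
  rw [← EReal.coe_ennreal_add]
  exact EReal.coe_ennreal_le_coe_ennreal_iff.2 h

section LogLoss

variable {N K : ℕ}

/-- The squared distance of the choice probabilities under two value vectors. -/
noncomputable def choiceSqDist (S : Assortment N K) (v u : Vec N) : ℝ :=
  ∑ y : Choice N, (mnlProb S v y - mnlProb S u y) ^ 2

lemma choiceSqDist_add_le (S : Assortment N K) (v u : Vec N) :
    ENNReal.ofReal (choiceSqDist S v u / 4)
        + ∑ y, ENNReal.ofReal (mnlProb S u y) * logLoss (mnlProb S u y) ≤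
      ∑ y, ENNReal.ofReal (mnlProb S u y) * logLoss (mnlProb S v y) := by
  by_cases h : ∃ y, 0 < mnlProb S u y ∧ ¬ 0 < mnlProb S v y
  · obtain ⟨y, hy, hy'⟩ := h
    have : ENNReal.ofReal (mnlProb S u y) * logLoss (mnlProb S v y) = ⊤ := by
      rw [logLoss, if_neg hy']
      exact ENNReal.mul_top (by simpa using hy)
    refine le_top.trans (this.symm.le.trans ?_)
    exact Finset.single_le_sum (f := fun y => ENNReal.ofReal (mnlProb S u y) *
      logLoss (mnlProb S v y)) (fun _ _ => zero_le) (Finset.mem_univ y)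
  · push Not at h
    have hterm : ∀ y (w : Vec N), (0 < mnlProb S u y → 0 < mnlProb S w y) →
        ENNReal.ofReal (mnlProb S u y) * logLoss (mnlProb S w y) =
          ENNReal.ofReal (mnlProb S u y * -Real.log (mnlProb S w y)) := by
      intro y w hw
      rcases (mnlProb_nonneg S u y).eq_or_lt with h0 | h0
      · simp [← h0]
      · rw [logLoss, if_pos (hw h0), ENNReal.ofReal_mul h0.le]
    have hnn : ∀ y (w : Vec N), 0 ≤ mnlProb S u y * -Real.log (mnlProb S w y) := fun y w =>
      mul_nonneg (mnlProb_nonneg _ _ _) (neg_nonneg.2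
        (Real.log_nonpos (mnlProb_nonneg _ _ _) (mnlProb_le_one _ _ _)))
    rw [Finset.sum_congr rfl fun y _ => hterm y u id, Finset.sum_congr rfl fun y _ =>
        hterm y v (h y), ← ENNReal.ofReal_sum_of_nonneg fun y _ => hnn y u,
      ← ENNReal.ofReal_sum_of_nonneg fun y _ => hnn y v, ← ENNReal.ofReal_add]
    · refine ENNReal.ofReal_le_ofReal ?_
      have hs : ∑ y, (mnlProb S u y - mnlProb S v y) = 0 := by
        rw [Finset.sum_sub_distrib, sum_mnlProb, sum_mnlProb, sub_self]
      have := Finset.sum_le_sum fun y (_ : y ∈ Finset.univ) =>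
        sq_sub_div_four_le (mnlProb_nonneg S u y) (mnlProb_le_one S u y) (mnlProb_nonneg S v y)
          (mnlProb_le_one S v y) (by
            rcases (mnlProb_nonneg S u y).eq_or_lt with h0 | h0
            · exact Or.inr h0.symm
            · exact Or.inl (h y h0))
      rw [Finset.sum_add_distrib, Finset.sum_add_distrib, hs, add_zero, ← Finset.sum_div] at this
      have hsymm : choiceSqDist S v u = ∑ y, (mnlProb S u y - mnlProb S v y) ^ 2 :=
        Finset.sum_congr rfl fun y _ => by ring
      rwa [hsymm]
    · exact div_nonneg (Finset.sum_nonneg fun _ _ => sq_nonneg _) (by norm_num)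
    · exact Finset.sum_nonneg fun y _ => hnn y u

lemma sum_mul_logLoss_self_le (S : Assortment N K) (u : Vec N) :
    ∑ y, ENNReal.ofReal (mnlProb S u y) * logLoss (mnlProb S u y) ≤
      Fintype.card (Choice N) := by
  calc ∑ y, ENNReal.ofReal (mnlProb S u y) * logLoss (mnlProb S u y)
      ≤ ∑ _y : Choice N, (1 : ENNReal) := by
        refine Finset.sum_le_sum fun y _ => ?_
        rcases (mnlProb_nonneg S u y).eq_or_lt with h0 | h0
        · simp [← h0]
        · rw [logLoss, if_pos h0, ← ENNReal.ofReal_mul h0.le, ENNReal.ofReal_le_one]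
          have := Real.one_sub_inv_le_log_of_pos h0
          have h2 := mul_le_mul_of_nonneg_left this h0.le
          have h3 : mnlProb S u y * (1 - (mnlProb S u y)⁻¹) = mnlProb S u y - 1 := by
            field_simp
          linarith
    _ = _ := by simp

lemma lintegral_mnlMeasure (S : Assortment N K) (u : Vec N) (φ : Choice N → ENNReal) :
    ∫⁻ y, φ y ∂mnlMeasure S u = ∑ y, ENNReal.ofReal (mnlProb S u y) * φ y := by
  rw [mnlMeasure, lintegral_finsetSum_measure]
  exact Finset.sum_congr rfl fun y _ => by
    rw [lintegral_smul_measure, lintegral_dirac, smul_eq_mul]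

variable {X : Type*} [MeasurableSpace X]

lemma measurable_mnlProb_sample {g : X → Vec N} (hg : Measurable g) :
    Measurable fun z : Sample X N K => mnlProb z.1.2 (g z.1.1) z.2 :=
  measurable_from_prod_countable_left fun y => measurable_mnlProb hg y

lemma expLogLoss_compProd (G : Measure (X × Assortment N K)) [IsProbabilityMeasure G]
    {f g : X → Vec N} (hf : Measurable f) (hg : Measurable g) :
    expLogLoss (G ⊗ₘ mnlKernel K f hf) g =
      ∫⁻ p, ∑ y, ENNReal.ofReal (mnlProb p.2 (f p.1) y) * logLoss (mnlProb p.2 (g p.1) y) ∂G := by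
  rw [expLogLoss, Measure.lintegral_compProd
    (f := fun z : Sample X N K => logLoss (mnlProb z.1.2 (g z.1.1) z.2))
    (measurable_logLoss.comp (measurable_mnlProb_sample hg))]
  exact lintegral_congr fun p => lintegral_mnlMeasure p.2 (f p.1) _

lemma measurable_choiceSqDist {f g : X → Vec N} (hf : Measurable f) (hg : Measurable g) :
    Measurable fun p : X × Assortment N K => choiceSqDist p.2 (g p.1) (f p.1) := by
  unfold choiceSqDist
  have h1 := fun y => measurable_mnlProb (K := K) hf y
  have h2 := fun y => measurable_mnlProb (K := K) hg y
  fun_prop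

lemma lintegral_choiceSqDist_le (G : Measure (X × Assortment N K)) [IsProbabilityMeasure G]
    {f g : X → Vec N} (hf : Measurable f) (hg : Measurable g) {e : ℝ}
    (h : excessLogLoss (G ⊗ₘ mnlKernel K f hf) g f ≤ (e : EReal)) :
    ∫⁻ p, ENNReal.ofReal (choiceSqDist p.2 (g p.1) (f p.1) / 4) ∂G ≤ ENNReal.ofReal e := by
  set D := ∫⁻ p, ENNReal.ofReal (choiceSqDist p.2 (g p.1) (f p.1) / 4) ∂G
  have hsum : D + expLogLoss (G ⊗ₘ mnlKernel K f hf) f ≤ expLogLoss (G ⊗ₘ mnlKernel K f hf) g := by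
    rw [expLogLoss_compProd G hf hf, expLogLoss_compProd G hf hg, ← lintegral_add_left]
    · exact lintegral_mono fun p => choiceSqDist_add_le p.2 (g p.1) (f p.1)
    · exact ((measurable_choiceSqDist hf hg).div_const 4).ennreal_ofReal
  have hfin : expLogLoss (G ⊗ₘ mnlKernel K f hf) f ≠ ⊤ := by
    rw [expLogLoss_compProd G hf hf]
    have hle : ∫⁻ p, ∑ y, ENNReal.ofReal (mnlProb p.2 (f p.1) y) *
        logLoss (mnlProb p.2 (f p.1) y) ∂G ≤ ∫⁻ _p, (Fintype.card (Choice N) : ENNReal) ∂G :=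
      lintegral_mono fun p => sum_mul_logLoss_self_le p.2 (f p.1)
    rw [lintegral_const, measure_univ, mul_one] at hle
    exact (hle.trans_lt (ENNReal.natCast_lt_top _)).ne
  have h2 : (D : EReal) ≤ (e : EReal) := by
    refine le_trans ?_ h
    rw [excessLogLoss]
    exact coe_ennreal_le_sub hfin hsum
  have h3 : (e : EReal) ≤ (ENNReal.ofReal e : EReal) := by
    rw [EReal.coe_ennreal_ofReal]
    exact EReal.coe_le_coe_iff.2 (le_max_left e 0)
  exact EReal.coe_ennreal_le_coe_ennreal_iff.1 (h2.trans h3)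

/-- The squared error of `v` on the items of `S`, in terms of the choice probabilities. -/
lemma sum_sq_sub_le_choiceSqDist (S : Assortment N K) (v u : Vec N) :
    ∑ i ∈ S.1, ((v i : ℝ) - u i) ^ 2 ≤
      8 * ((K : ℝ) + 1) ^ 4 * (choiceSqDist S v u / 4) := by
  have h := sum_sq_sub_le_sum_mnlProb S v u
  have h0 : 0 ≤ choiceSqDist S v u := Finset.sum_nonneg fun _ _ => sq_nonneg _
  have hc : ((S.1.card : ℝ) + 1) ≤ (K : ℝ) + 1 := by
    have : (S.1.card : ℝ) ≤ K := by exact_mod_cast S.2.2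
    linarith
  have h3 : ((S.1.card : ℝ) + 1) ^ 3 ≤ ((K : ℝ) + 1) ^ 4 :=
    calc ((S.1.card : ℝ) + 1) ^ 3 ≤ ((K : ℝ) + 1) ^ 3 := by gcongr
      _ ≤ ((K : ℝ) + 1) ^ 4 :=
        pow_le_pow_right₀ (by linarith [K.cast_nonneg (α := ℝ)]) (by norm_num)
  calc _ ≤ _ := h
    _ ≤ 2 * ((K : ℝ) + 1) ^ 4 * choiceSqDist S v u := by
      rw [choiceSqDist] at *
      gcongr
    _ = _ := by ring

end LogLoss

/-! ### A single sample forces the whole class to be close -/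

section SupClose

variable {N K : ℕ} {X : Type*} [MeasurableSpace X]

lemma measurable_choiceSqDist_left (S : Assortment N K) (u : Vec N) :
    Measurable fun v : Vec N => choiceSqDist S v u := by
  unfold choiceSqDist
  have h := fun y => (measurable_mnlProb (K := K) (measurable_id (α := Vec N)) y).comp
    (measurable_id.prodMk (measurable_const (a := S)))
  simp only [Function.comp_def, id] at h
  fun_prop

lemma IsOfflineOracle.measurable_apply {F : Set (X → Vec N)} {A : OracleMap X N K}
    {Err : ℕ → ℝ → ℝ} (hA : IsOfflineOracle F A Err) (n : ℕ) (data : Dataset X N K n) :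
    Measurable (A n data) :=
  (hA.measurable n).comp measurable_prodMk_left

/-- If the only item of `S` is offered in the context `x`, then the outcome "no purchase" has
probability at least `1 / 2` under any true value function. Hence it cannot belong to the failure
event of the oracle, and the answer of the oracle to it is accurate for every `f ∈ F`. -/
lemma IsOfflineOracle.choiceSqDist_le_of_card_eq_one {F : Set (X → Vec N)}
    {A : OracleMap X N K} {Err : ℕ → ℝ → ℝ} (hA : IsOfflineOracle F A Err) {δ : ℝ}
    (hδ : δ ∈ Set.Ioo (0 : ℝ) 1) (hδ2 : δ < 1 / 2) (hErr : 0 ≤ Err 1 δ)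
    {f : X → Vec N} (hfF : f ∈ F) (hf : Measurable f) (x : X) (S : Assortment N K)
    (hS : S.1.card = 1) :
    choiceSqDist S (A 1 (fun _ => ((x, S), none)) x) (f x) / 4 ≤ Err 1 δ := by
  by_contra hcon
  -- The oracle is queried on samples whose context and assortment are deterministic.
  set H := Measure.dirac (x, S) ⊗ₘ mnlKernel K f hf with hH
  let E' : Set (Dataset X N K 1) := {data | choiceSqDist S (A 1 data x) (f x) / 4 ≤ Err 1 δ}
  have hAx : Measurable fun data : Dataset X N K 1 => A 1 data x :=
    (hA.measurable 1).comp measurable_prodMk_right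
  have hE' : MeasurableSet E' :=
    measurableSet_le (((measurable_choiceSqDist_left S (f x)).comp hAx).div_const 4)
      measurable_const
  have h1 : ENNReal.ofReal (1 - δ) ≤ Measure.pi (fun _ : Fin 1 => H) E' := by
    refine (hA.gen_error 1 le_rfl δ hδ f hfF hf (Measure.dirac (x, S)) inferInstance).trans
      (measure_mono fun data hdata => ?_)
    have := lintegral_choiceSqDist_le (Measure.dirac (x, S)) hf (hA.measurable_apply 1 data) hdata
    rw [lintegral_dirac' _
      ((measurable_choiceSqDist hf (hA.measurable_apply 1 data)).div_const 4).ennreal_ofReal]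
      at this
    exact (ENNReal.ofReal_le_ofReal_iff hErr).1 this
  have h2 : Measure.pi (fun _ : Fin 1 => H) E' = H {z | (fun _ => z) ∈ E'} := by
    have hmp := (measurePreserving_funUnique H (Fin 1)).symm
    have := hmp.measure_preimage (s := E') hE'.nullMeasurableSet
    convert this.symm
    rfl
  have hmeas : MeasurableSet {z : Sample X N K | (fun _ : Fin 1 => z) ∈ E'} :=
    (measurable_pi_lambda (fun (z : Sample X N K) (_ : Fin 1) => z)
      (fun _ => measurable_id)) hE'
  have h3 : H {z | (fun _ => z) ∈ E'} =
      mnlMeasure S (f x) {y | (fun _ => ((x, S), y)) ∈ E'} := by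
    rw [hH, Measure.compProd_apply hmeas,
      lintegral_dirac' _ (Kernel.measurable_kernel_prodMk_left hmeas)]
    rfl
  have h4 : mnlMeasure S (f x) {y | (fun _ => ((x, S), y)) ∈ E'} ≤
      mnlMeasure S (f x) {none}ᶜ :=
    measure_mono fun y hy hy0 => hcon (by rw [Set.mem_singleton_iff.1 hy0] at hy; exact hy)
  have h5 : ENNReal.ofReal (1 / 2) ≤ mnlMeasure S (f x) {none} := by
    rw [← lintegral_indicator_one (measurableSet_singleton _), lintegral_mnlMeasure]
    refine le_trans ?_ (Finset.single_le_sum (f := fun y => ENNReal.ofReal (mnlProb S (f x) y) *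
      Set.indicator {none} 1 y) (fun _ _ => zero_le) (Finset.mem_univ none))
    simp only [Set.mem_singleton_iff, Set.indicator_of_mem, Pi.one_apply, mul_one]
    refine ENNReal.ofReal_le_ofReal ?_
    simp only [mnlProb]
    have h0 : 0 ≤ ∑ j ∈ S.1, (f x j : ℝ) := Finset.sum_nonneg fun j _ => (f x j).2.1
    refine one_div_le_one_div_of_le (by linarith) ?_
    have : ∑ j ∈ S.1, (f x j : ℝ) ≤ ∑ _j ∈ S.1, (1 : ℝ) :=
      Finset.sum_le_sum fun i _ => (f x i).2.2
    rw [Finset.sum_const, hS, one_smul] at this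
    linarith
  rw [h2, h3] at h1
  rw [prob_compl_eq_one_sub (measurableSet_singleton _)] at h4
  have h6 := (h1.trans h4).trans (tsub_le_tsub_left h5 1)
  rw [← ENNReal.ofReal_one, ← ENNReal.ofReal_sub _ (by norm_num),
    ENNReal.ofReal_le_ofReal_iff (by norm_num)] at h6
  linarith

/-- All measurable members of `F` are uniformly close to each other, since the oracle has to
answer the same data set `(x, {i}, no purchase)` accurately for each of them. -/
lemma IsOfflineOracle.sq_sub_le (hK : 1 ≤ K) {F : Set (X → Vec N)}
    {A : OracleMap X N K} {Err : ℕ → ℝ → ℝ} (hA : IsOfflineOracle F A Err) {δ : ℝ}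
    (hδ : δ ∈ Set.Ioo (0 : ℝ) 1) (hδ2 : δ < 1 / 2) (hErr : 0 ≤ Err 1 δ)
    {f g : X → Vec N} (hfF : f ∈ F) (hf : Measurable f) (hgF : g ∈ F) (hg : Measurable g)
    (x : X) (i : Fin N) : ((g x i : ℝ) - f x i) ^ 2 ≤ 256 * Err 1 δ := by
  let S : Assortment N K := ⟨{i}, by simp, by simpa using hK⟩
  set h := A 1 (fun _ => ((x, S), none)) x
  have key : ∀ u : X → Vec N, u ∈ F → Measurable u → ((h i : ℝ) - u x i) ^ 2 ≤ 64 * Err 1 δ := by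
    intro u huF hu
    have h1 := hA.choiceSqDist_le_of_card_eq_one hδ hδ2 hErr huF hu x S (by simp [S])
    have h2 := sum_sq_sub_le_sum_mnlProb S h (u x)
    change _ ≤ _ * choiceSqDist S h (u x) at h2
    simp only [S, Finset.sum_singleton, Finset.card_singleton] at h2
    norm_num at h2
    linarith
  have h1 := key f hfF hf
  have h2 := key g hgF hg
  nlinarith [sq_nonneg ((h i : ℝ) - f x i + (h i - g x i))]

end SupClose

/-! ### The law of the interaction -/

/-- Integrals against a conditional distribution are iterated integrals. -/
lemma lintegral_of_hasCondDistrib {Ω 𝓧 𝓨 : Type*} [MeasurableSpace Ω] [MeasurableSpace 𝓧]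
    [MeasurableSpace 𝓨] {P : Measure Ω} [SFinite P] {Y : Ω → 𝓨} {U : Ω → 𝓧} {κ : Kernel 𝓧 𝓨}
    [IsSFiniteKernel κ] (h : HasCondDistrib Y U κ P) {φ : 𝓧 × 𝓨 → ENNReal} (hφ : Measurable φ) :
    ∫⁻ ω, φ (U ω, Y ω) ∂P = ∫⁻ ω, ∫⁻ y, φ (U ω, y) ∂κ (U ω) ∂P := by
  rw [← lintegral_map' (f := φ) (g := fun ω => (U ω, Y ω)) hφ.aemeasurable h.aemeasurable,
    h.map_eq, Measure.lintegral_compProd hφ,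
    lintegral_map' (hφ.lintegral_kernel_prod_right').aemeasurable h.aemeasurable_fst]

section Interaction

variable {N K : ℕ} {X : Type*} [MeasurableSpace X]

/-- The law of the pair (context, assortment) when the assortments are drawn from the policy `κ`
that was computed from the data `u`. -/
noncomputable def designKernel {U : Type*} [MeasurableSpace U] (D : Measure (X × Vec N))
    (κ : Kernel (U × (X × Vec N)) (Assortment N K)) : Kernel U (X × Assortment N K) :=
  (Kernel.const U D ⊗ₖ κ).map fun p => (p.1.1, p.2)

instance {U : Type*} [MeasurableSpace U] (D : Measure (X × Vec N)) [IsProbabilityMeasure D]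
    (κ : Kernel (U × (X × Vec N)) (Assortment N K)) [IsMarkovKernel κ] :
    IsMarkovKernel (designKernel D κ) :=
  Kernel.IsMarkovKernel.map _ (by fun_prop)

lemma lintegral_designKernel {U : Type*} [MeasurableSpace U] (D : Measure (X × Vec N))
    [IsProbabilityMeasure D] (κ : Kernel (U × (X × Vec N)) (Assortment N K)) [IsMarkovKernel κ]
    (u : U) {φ : X × Assortment N K → ENNReal} (hφ : Measurable φ) :
    ∫⁻ p, φ p ∂designKernel D κ u = ∫⁻ c, ∫⁻ S, φ (c.1, S) ∂κ (u, c) ∂D := by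
  have hm : Measurable fun p : (X × Vec N) × Assortment N K => (p.1.1, p.2) := by fun_prop
  rw [designKernel, Kernel.map_apply _ hm, lintegral_map hφ hm,
    Kernel.lintegral_compProd _ _ _
      (f := fun a : (X × Vec N) × Assortment N K => φ (a.1.1, a.2)) (hφ.comp hm),
    Kernel.const_apply]

/-- The law of a sample when the assortments are drawn from the policy `κ`. -/
noncomputable def sampleKernel {U : Type*} [MeasurableSpace U] (D : Measure (X × Vec N))
    (κ : Kernel (U × (X × Vec N)) (Assortment N K)) (f : X → Vec N) (hf : Measurable f) :
    Kernel U (Sample X N K) :=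
  designKernel D κ ⊗ₖ Kernel.prodMkLeft U (mnlKernel K f hf)

instance {U : Type*} [MeasurableSpace U] (D : Measure (X × Vec N)) [IsProbabilityMeasure D]
    (κ : Kernel (U × (X × Vec N)) (Assortment N K)) [IsMarkovKernel κ] (f : X → Vec N)
    (hf : Measurable f) : IsMarkovKernel (sampleKernel D κ f hf) := by
  unfold sampleKernel
  infer_instance

lemma sampleKernel_apply {U : Type*} [MeasurableSpace U] (D : Measure (X × Vec N))
    [IsProbabilityMeasure D] (κ : Kernel (U × (X × Vec N)) (Assortment N K)) [IsMarkovKernel κ]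
    (f : X → Vec N) (hf : Measurable f) (u : U) :
    sampleKernel D κ f hf u = designKernel D κ u ⊗ₘ mnlKernel K f hf := by
  rw [sampleKernel, Kernel.compProd_apply_eq_compProd_sectR, Kernel.sectR_prodMkLeft]

lemma lintegral_sampleKernel {U : Type*} [MeasurableSpace U] (D : Measure (X × Vec N))
    [IsProbabilityMeasure D] (κ : Kernel (U × (X × Vec N)) (Assortment N K)) [IsMarkovKernel κ]
    (f : X → Vec N) (hf : Measurable f) (u : U) {φ : Sample X N K → ENNReal}
    (hφ : Measurable φ) :
    ∫⁻ z, φ z ∂sampleKernel D κ f hf u =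
      ∫⁻ c, ∫⁻ S, ∫⁻ y, φ ((c.1, S), y) ∂mnlMeasure S (f c.1) ∂κ (u, c) ∂D := by
  rw [sampleKernel_apply, Measure.lintegral_compProd hφ,
    lintegral_designKernel D κ u hφ.lintegral_kernel_prod_right']
  rfl

/-- The part of the record of a round that is given to the oracle. -/
def toSample (z : Round X N K) : Sample X N K := ((z.1.1, z.2.1), z.2.2)

lemma measurable_toSample : Measurable (toSample (X := X) (N := N) (K := K)) := by
  unfold toSample
  fun_prop

variable {Ω : Type*} [MeasurableSpace Ω]

/-- The data set that the oracle receives at the beginning of epoch `m`, as a random variable. -/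
def epochSamples (Z : ℕ → Ω → Round X N K) (m : ℕ) (ω : Ω) : Dataset X N K (epochSize m) :=
  fun k => toSample (Z (τ (m - 1) + k) ω)

variable {P : Measure Ω} [IsProbabilityMeasure P] {Z : ℕ → Ω → Round X N K}
  {D : Measure (X × Vec N)} [IsProbabilityMeasure D] {q : PolicyFamily X N K}
  {f : X → Vec N} {hf : Measurable f} {T : ℕ}

/-- The law of one round given the past. -/
lemma IsInteraction.lintegral_round (hZ : IsInteraction P Z D q f hf T)
    (hq : ∀ m, IsMarkovKernel (q m)) {t m : ℕ} (htT : t < T) (h : τ m ≤ t) (h' : t < τ (m + 1))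
    {φ : (Fin t → Round X N K) × Round X N K → ENNReal} (hφ : Measurable φ) :
    ∫⁻ ω, φ (past Z t ω, Z t ω) ∂P =
      ∫⁻ ω, ∫⁻ c, ∫⁻ S, ∫⁻ y, φ (past Z t ω, (c, S, y)) ∂mnlMeasure S (f c.1)
        ∂q m (epochSamples Z m ω, c) ∂D ∂P := by
  have := hq m
  let κ3 : Kernel (((Fin t → Round X N K) × (X × Vec N)) × Assortment N K) (Choice N) :=
    (mnlKernel K f hf).comap (fun p => (p.1.2.1, p.2)) (by fun_prop)
  let κ2 : Kernel ((Fin t → Round X N K) × (X × Vec N)) (Assortment N K) :=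
    (q m).comap (Prod.map (epochData m t h) id)
        ((measurable_epochData m t h).prodMap measurable_id)
  have hφ3 : Measurable fun p : (((Fin t → Round X N K) × (X × Vec N)) × Assortment N K) ×
      Choice N => φ (p.1.1.1, (p.1.1.2, p.1.2, p.2)) := hφ.comp (by fun_prop)
  have hφ2 : Measurable fun p => ∫⁻ y, φ (p.1.1, (p.1.2, p.2, y)) ∂κ3 p :=
    hφ3.lintegral_kernel_prod_right'
  have hφ1 : Measurable fun p : (Fin t → Round X N K) × (X × Vec N) =>
      ∫⁻ S, ∫⁻ y, φ (p.1, (p.2, S, y)) ∂κ3 (p, S) ∂κ2 p := hφ2.lintegral_kernel_prod_right'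
  have e3 := lintegral_of_hasCondDistrib (hZ.choice t htT) hφ3
  have e2 := lintegral_of_hasCondDistrib (hZ.assortment t htT m h h') hφ2
  have e1 := lintegral_of_hasCondDistrib (hZ.context t htT) hφ1
  exact e3.trans (e2.trans e1)

/-- The samples of an epoch are i.i.d. given the data from which its policy was computed. -/
lemma IsInteraction.lintegral_epochSamples_aux (hZ : IsInteraction P Z D q f hf T)
    (hq : ∀ m, IsMarkovKernel (q m)) (m j : ℕ) (hj : τ m + j ≤ τ (m + 1)) (hjT : τ m + j ≤ T)
    {φ : Dataset X N K (epochSize m) × (Fin j → Sample X N K) → ENNReal} (hφ : Measurable φ) :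
    ∫⁻ ω, φ (epochSamples Z m ω, fun k : Fin j => toSample (Z (τ m + k) ω)) ∂P =
      ∫⁻ ω, ∫⁻ v, φ (epochSamples Z m ω, v)
        ∂Measure.pi (fun _ : Fin j => sampleKernel D (q m) f hf (epochSamples Z m ω)) ∂P := by
  have := hq m
  induction j with
  | zero =>
    refine lintegral_congr fun ω => ?_
    have : ∀ v : Fin 0 → Sample X N K, φ (epochSamples Z m ω, v) =
        φ (epochSamples Z m ω, fun k : Fin 0 => toSample (Z (τ m + k) ω)) := fun v => by
      rw [Subsingleton.elim v]
    simp_rw [this]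
    rw [lintegral_const, measure_univ, mul_one]
  | succ j ih =>
    let e := MeasurableEquiv.piFinSuccAbove (fun _ : Fin (j + 1) => Sample X N K) (Fin.last j)
    have hle : τ m ≤ τ m + j := Nat.le_add_right _ _
    let ψ : (Fin (τ m + j) → Round X N K) × Round X N K → ENNReal := fun p =>
      φ (epochData m (τ m + j) hle p.1, e.symm (toSample p.2,
        fun k : Fin j => toSample (p.1 ⟨τ m + k, by omega⟩)))
    have hψ : Measurable ψ := by
      refine hφ.comp (((measurable_epochData m _ hle).comp measurable_fst).prodMk
        (e.symm.measurable.comp ((measurable_toSample.comp measurable_snd).prodMk ?_)))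
      exact measurable_pi_lambda _ fun k =>
        measurable_toSample.comp ((measurable_pi_apply _).comp measurable_fst)
    have hsnoc : ∀ ω, (fun k : Fin (j + 1) => toSample (Z (τ m + k) ω)) =
        e.symm (toSample (Z (τ m + j) ω), fun k : Fin j => toSample (Z (τ m + k) ω)) := by
      intro ω
      rw [MeasurableEquiv.eq_symm_apply]
      refine Prod.ext rfl ?_
      funext k
      simp [e, MeasurableEquiv.piFinSuccAbove, Fin.init]
    have h1 := hZ.lintegral_round hq (t := τ m + j) (m := m) (by omega) hle (by omega) hψ
    have hφ' : Measurable fun p : (Dataset X N K (epochSize m) × (Fin j → Sample X N K)) ×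
        Sample X N K => φ (p.1.1, e.symm (p.2, p.1.2)) :=
      hφ.comp ((measurable_fst.comp measurable_fst).prodMk
        (e.symm.measurable.comp (measurable_snd.prodMk (measurable_snd.comp measurable_fst))))
    let κ : Kernel (Dataset X N K (epochSize m) × (Fin j → Sample X N K)) (Sample X N K) :=
      (sampleKernel D (q m) f hf).comap Prod.fst measurable_fst
    have h2 := ih (by omega) (by omega) (hφ'.lintegral_kernel_prod_right' (κ := κ))
    calc ∫⁻ ω, φ (epochSamples Z m ω, fun k : Fin (j + 1) => toSample (Z (τ m + k) ω)) ∂P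
        = ∫⁻ ω, ψ (past Z (τ m + j) ω, Z (τ m + j) ω) ∂P :=
          lintegral_congr fun ω => by rw [hsnoc ω]; rfl
      _ = _ := h1
      _ = ∫⁻ ω, ∫⁻ z, φ (epochSamples Z m ω, e.symm (z,
            fun k : Fin j => toSample (Z (τ m + k) ω)))
            ∂sampleKernel D (q m) f hf (epochSamples Z m ω) ∂P := by
          refine lintegral_congr fun ω => ?_
          rw [lintegral_sampleKernel D (q m) f hf (epochSamples Z m ω)
            (φ := fun z => φ (epochSamples Z m ω, e.symm (z,
              fun k : Fin j => toSample (Z (τ m + k) ω)))) (hφ.comp (measurable_const.prodMk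
              (e.symm.measurable.comp (measurable_id.prodMk measurable_const))))]
          rfl
      _ = _ := h2
      _ = _ := by
          refine lintegral_congr fun ω => ?_
          set H := sampleKernel D (q m) f hf (epochSamples Z m ω) with hH
          have hmp := (measurePreserving_piFinSuccAbove (fun _ : Fin (j + 1) => H)
            (Fin.last j)).symm
          have hm : Measurable fun v : Fin (j + 1) → Sample X N K => φ (epochSamples Z m ω, v) :=
            hφ.comp measurable_prodMk_left
          rw [← hmp.lintegral_comp hm]
          exact (lintegral_prod_symm' (μ := H) (ν := Measure.pi fun _ : Fin j => H)
            (fun z => φ (epochSamples Z m ω, e.symm z))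
            (hm.comp hmp.measurable)).symm

lemma IsInteraction.lintegral_epochSamples (hZ : IsInteraction P Z D q f hf T)
    (hq : ∀ m, IsMarkovKernel (q m)) (m : ℕ) (hT : τ (m + 1) ≤ T)
    {φ : Dataset X N K (epochSize m) × Dataset X N K (epochSize (m + 1)) → ENNReal}
    (hφ : Measurable φ) :
    ∫⁻ ω, φ (epochSamples Z m ω, epochSamples Z (m + 1) ω) ∂P =
      ∫⁻ ω, ∫⁻ v, φ (epochSamples Z m ω, v)
        ∂Measure.pi (fun _ : Fin (epochSize (m + 1)) =>
          sampleKernel D (q m) f hf (epochSamples Z m ω)) ∂P := by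
  have hmono : τ m ≤ τ (m + 1) := Nat.sub_le_sub_right (Nat.pow_le_pow_right two_pos (by omega)) 1
  have hsize : τ m + epochSize (m + 1) = τ (m + 1) := by
    simp only [epochSize, Nat.add_sub_cancel]
    omega
  exact hZ.lintegral_epochSamples_aux hq m (epochSize (m + 1)) hsize.le (hsize.le.trans hT) hφ

end Interaction

/-! ### The expected estimation error of one epoch -/

section EpochError

variable {N K : ℕ} {X : Type*} [MeasurableSpace X]

lemma ofReal_sum_real_mul (κ : Measure (Assortment N K)) [IsProbabilityMeasure κ]
    {g : Assortment N K → ℝ} (hg : ∀ S, 0 ≤ g S) :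
    ENNReal.ofReal (∑ S, κ.real {S} * g S) = ∫⁻ S, ENNReal.ofReal (g S) ∂κ := by
  rw [lintegral_fintype, ENNReal.ofReal_sum_of_nonneg fun S _ =>
    mul_nonneg measureReal_nonneg (hg S)]
  refine Finset.sum_congr rfl fun S _ => ?_
  rw [ENNReal.ofReal_mul measureReal_nonneg, ofReal_measureReal, mul_comm]

lemma measurable_sum_sq_sub {U : Type*} [MeasurableSpace U] {g : U × X → Vec N}
    (hg : Measurable g) {f : X → Vec N} (hf : Measurable f) :
    Measurable fun p : U × (X × Assortment N K) =>
      ∑ i ∈ p.2.2.1, ((g (p.1, p.2.1) i : ℝ) - f p.2.1 i) ^ 2 := by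
  have h : Measurable fun p : (U × X) × Assortment N K =>
      ∑ i ∈ p.2.1, ((g p.1 i : ℝ) - f p.1.2 i) ^ 2 := by
    apply measurable_from_prod_countable_left
    intro S
    dsimp only
    fun_prop
  exact h.comp (g := fun p : (U × X) × Assortment N K =>
      ∑ i ∈ p.2.1, ((g p.1 i : ℝ) - f p.1.2 i) ^ 2)
    (f := fun p : U × (X × Assortment N K) => ((p.1, p.2.1), p.2.2)) (by fun_prop)

/-- The mean squared error of the value predictor `a p.2`, estimated from the data `p.2`, on
assortments drawn from the policy `κ` that was computed from the data `p.1`. It is an integral over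
the law `designKernel D κ p.1` of the samples, hence a function of the two data sets alone. -/
noncomputable def designError {U V : Type*} [MeasurableSpace U]
    (D : Measure (X × Vec N)) (κ : Kernel (U × (X × Vec N)) (Assortment N K))
    (a : V → X → Vec N) (f : X → Vec N) (p : U × V) : ENNReal :=
  ∫⁻ z, ENNReal.ofReal (∑ i ∈ z.2.1, ((a p.2 z.1 i : ℝ) - f z.1 i) ^ 2) ∂designKernel D κ p.1

lemma measurable_sqError_right {U : Type*} [MeasurableSpace U]
    {κ : Kernel (U × (X × Vec N)) (Assortment N K)} {f g : X → Vec N}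
    (hf : Measurable f) (hg : Measurable g) (u : U) :
    Measurable fun c : X × Vec N =>
      sqError (fun S => (κ (u, c)).real {S}) (g c.1) (f c.1) := by
  unfold sqError
  have h : ∀ S : Assortment N K, Measurable fun c : X × Vec N => (κ (u, c)).real {S} := fun S =>
    ((κ.measurable_coe (measurableSet_singleton S)).comp measurable_prodMk_left).ennreal_toReal
  fun_prop

variable {U V : Type*} [MeasurableSpace U]
  {D : Measure (X × Vec N)} [IsProbabilityMeasure D]
  {κ : Kernel (U × (X × Vec N)) (Assortment N K)} [IsMarkovKernel κ]

lemma measurable_designError [MeasurableSpace V] {a : V → X → Vec N}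
    (ha : Measurable fun p : V × X => a p.1 p.2)
    {f : X → Vec N} (hf : Measurable f) : Measurable (designError D κ a f) := by
  have h := ((measurable_sum_sq_sub (K := K) (g := fun p : (U × V) × X => a p.1.2 p.2)
    (ha.comp ((measurable_snd.comp measurable_fst).prodMk measurable_snd)) hf).ennreal_ofReal)
  exact h.lintegral_kernel_prod_right' (κ := (designKernel D κ).comap Prod.fst measurable_fst)

lemma lintegral_sqError {a : V → X → Vec N} (ha : ∀ v, Measurable (a v))
    {f : X → Vec N} (hf : Measurable f) (u : U) (v : V) :
    ∫⁻ c, ENNReal.ofReal (sqError (fun S => (κ (u, c)).real {S}) (a v c.1) (f c.1)) ∂D =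
      designError D κ a f (u, v) := by
  have hm := measurable_sum_sq_sub (K := K) (U := Unit) (g := fun p : Unit × X => a v p.2)
    ((ha v).comp measurable_snd) hf
  rw [designError, lintegral_designKernel D κ u
    (φ := fun z => ENNReal.ofReal (∑ i ∈ z.2.1, ((a v z.1 i : ℝ) - f z.1 i) ^ 2))
    (hm.ennreal_ofReal.comp (measurable_prodMk_left (x := ())))]
  refine lintegral_congr fun c => ?_
  exact ofReal_sum_real_mul (κ (u, c)) fun S => Finset.sum_nonneg fun i _ => sq_nonneg _

variable {Ω : Type*} [MeasurableSpace Ω] {P : Measure Ω} [IsProbabilityMeasure P]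
  {Z : ℕ → Ω → Round X N K} {q : PolicyFamily X N K}
  {f : X → Vec N} {hf : Measurable f} {T : ℕ}

/-- On the success event of the oracle the error is at most of the order of `Err`; on the failure
event, of probability at most `δ`, it is still bounded by the diameter of the class. -/
lemma IsInteraction.lintegral_designError_le (hK : 1 ≤ K) {F : Set (X → Vec N)}
    {A : OracleMap X N K} {Err : ℕ → ℝ → ℝ} (hA : IsOfflineOracle F A Err) (hfF : f ∈ F)
    (hZ : IsInteraction P Z D q f hf T) (hq : ∀ m, IsMarkovKernel (q m)) {δ : ℝ}
    (hδ : δ ∈ Set.Ioo (0 : ℝ) 1) (hδ2 : δ < 1 / 2) (hErr : 0 ≤ Err 1 δ)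
    {m : ℕ} (hm : 1 ≤ epochSize (m + 1)) (hT : τ (m + 1) ≤ T) :
    ∫⁻ ω, designError D (q m) (A (epochSize (m + 1))) f
        (epochSamples Z m ω, epochSamples Z (m + 1) ω) ∂P ≤
      ENNReal.ofReal (8 * ((K : ℝ) + 1) ^ 4 * Err (epochSize (m + 1)) δ)
        + ENNReal.ofReal (256 * K * Err 1 δ) * ENNReal.ofReal δ := by
  have := hq m
  set n := epochSize (m + 1)
  set a := ENNReal.ofReal (8 * ((K : ℝ) + 1) ^ 4 * Err n δ)
  set b := ENNReal.ofReal (256 * K * Err 1 δ)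
  have hmeas : Measurable (designError D (q m) (A n) f) :=
    measurable_designError (hA.measurable n) hf
  rw [hZ.lintegral_epochSamples hq m hT hmeas]
  have hu : ∀ u, ∫⁻ v, designError D (q m) (A n) f (u, v)
      ∂Measure.pi (fun _ : Fin n => sampleKernel D (q m) f hf u) ≤ a + b * ENNReal.ofReal δ := by
    intro u
    have hmu : Measurable fun v => designError D (q m) (A n) f (u, v) :=
      hmeas.comp measurable_prodMk_left
    -- This contains the success event of the oracle and, unlike it, is visibly measurable.
    set good : Set (Dataset X N K n) := {v | designError D (q m) (A n) f (u, v) ≤ a}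
    have hgood : MeasurableSet good := measurableSet_le hmu measurable_const
    set Q := Measure.pi (fun _ : Fin n => sampleKernel D (q m) f hf u) with hQ
    have hprob : ENNReal.ofReal (1 - δ) ≤ Q good := by
      rw [hQ, sampleKernel_apply]
      refine (hA.gen_error n hm δ hδ f hfF hf (designKernel D (q m) u) inferInstance).trans
        (measure_mono fun v hv => ?_)
      have h1 := lintegral_choiceSqDist_le (designKernel D (q m) u) hf
        (hA.measurable_apply n v) hv
      calc designError D (q m) (A n) f (u, v)
          ≤ ∫⁻ z, ENNReal.ofReal (8 * ((K : ℝ) + 1) ^ 4) *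
              ENNReal.ofReal (choiceSqDist z.2 (A n v z.1) (f z.1) / 4)
                ∂designKernel D (q m) u := by
            refine lintegral_mono fun z => ?_
            rw [← ENNReal.ofReal_mul (by positivity)]
            exact ENNReal.ofReal_le_ofReal (sum_sq_sub_le_choiceSqDist z.2 (A n v z.1) (f z.1))
        _ = ENNReal.ofReal (8 * ((K : ℝ) + 1) ^ 4) *
              ∫⁻ z, ENNReal.ofReal (choiceSqDist z.2 (A n v z.1) (f z.1) / 4)
                ∂designKernel D (q m) u :=
            lintegral_const_mul _
              ((measurable_choiceSqDist hf (hA.measurable_apply n v)).div_const 4).ennreal_ofReal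
        _ ≤ ENNReal.ofReal (8 * ((K : ℝ) + 1) ^ 4) * ENNReal.ofReal (Err n δ) := by gcongr
        _ = a := (ENNReal.ofReal_mul (by positivity)).symm
    have hbad : Q goodᶜ ≤ ENNReal.ofReal δ := by
      rw [prob_compl_eq_one_sub hgood]
      refine (tsub_le_tsub_left hprob 1).trans ?_
      rw [← ENNReal.ofReal_one, ← ENNReal.ofReal_sub _ (by linarith [hδ.2]), sub_sub_cancel]
    have hbound : ∀ v, designError D (q m) (A n) f (u, v) ≤ b := by
      intro v
      have hz : ∀ z : X × Assortment N K,
          ENNReal.ofReal (∑ i ∈ z.2.1, ((A n v z.1 i : ℝ) - f z.1 i) ^ 2) ≤ b := by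
        intro z
        refine ENNReal.ofReal_le_ofReal ?_
        calc ∑ i ∈ z.2.1, ((A n v z.1 i : ℝ) - f z.1 i) ^ 2
            ≤ ∑ _i ∈ z.2.1, 256 * Err 1 δ := Finset.sum_le_sum fun i _ =>
              hA.sq_sub_le hK hδ hδ2 hErr hfF hf (hA.mem n v) (hA.measurable_apply n v) z.1 i
          _ = z.2.1.card * (256 * Err 1 δ) := by rw [Finset.sum_const, nsmul_eq_mul]
          _ ≤ K * (256 * Err 1 δ) := by
            have : (z.2.1.card : ℝ) ≤ K := by exact_mod_cast z.2.2.2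
            gcongr
          _ = _ := by ring
      calc designError D (q m) (A n) f (u, v) ≤ ∫⁻ _z, b ∂designKernel D (q m) u :=
            lintegral_mono hz
        _ = b := by rw [lintegral_const, measure_univ, mul_one]
    calc ∫⁻ v, designError D (q m) (A n) f (u, v) ∂Q
        ≤ ∫⁻ v, (a + goodᶜ.indicator (fun _ => b) v) ∂Q := by
          refine lintegral_mono fun v => ?_
          by_cases hv : v ∈ good
          · exact le_add_right hv
          · simp only [Set.indicator_of_mem (Set.mem_compl hv)]
            exact le_add_left (hbound v)
      _ = a + b * Q goodᶜ := by
          rw [lintegral_add_left measurable_const, lintegral_const, measure_univ, mul_one,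
            lintegral_indicator_const hgood.compl]
      _ ≤ _ := by gcongr
  calc _ ≤ ∫⁻ _ω, (a + b * ENNReal.ofReal δ) ∂P := lintegral_mono fun ω => hu _
    _ = _ := by rw [lintegral_const, measure_univ, mul_one]

end EpochError

/-! ### The expected regret of one round -/

/-- The errors `c ω y k` of the epochs have a bounded influence on epoch `m`, in expectation. -/
lemma lintegral_accumError_le {Ω Y : Type*} [MeasurableSpace Ω] [MeasurableSpace Y]
    {P : Measure Ω} {D : Measure Y} {c : Ω → Y → ℕ → ℝ} {B : ENNReal} (m : ℕ)
    (hc : ∀ ω y k, 0 ≤ c ω y k)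
    (hmeas : ∀ ω k, Measurable fun y => c ω y k)
    (hae : ∀ k, 1 ≤ k → k ≤ m → AEMeasurable (fun ω => ∫⁻ y, ENNReal.ofReal (c ω y k) ∂D) P)
    (hB : ∀ k, 1 ≤ k → k ≤ m → ∫⁻ ω, ∫⁻ y, ENNReal.ofReal (c ω y k) ∂D ∂P ≤ B) :
    ∫⁻ ω, ∫⁻ y, ENNReal.ofReal (accumError (c ω y) m) ∂D ∂P ≤ 3 * B := by
  induction m with
  | zero => simp [accumError]
  | succ m ih =>
    have ih := ih (fun k h1 h2 => hae k h1 (by omega)) fun k h1 h2 => hB k h1 (by omega)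
    have hpt : ∀ ω, ∫⁻ y, ENNReal.ofReal (accumError (c ω y) (m + 1)) ∂D =
        ENNReal.ofReal (1 / 4) * ∫⁻ y, ENNReal.ofReal (accumError (c ω y) m) ∂D +
          2 * ∫⁻ y, ENNReal.ofReal (c ω y (m + 1)) ∂D := by
      intro ω
      rw [← lintegral_const_mul' _ _ (by simp), ← lintegral_const_mul' _ _ (by simp),
        ← lintegral_add_right _ ((hmeas ω (m + 1)).ennreal_ofReal.const_mul 2)]
      refine lintegral_congr fun y => ?_
      have h1 := accumError_nonneg (hc ω y) m
      have h2 := hc ω y (m + 1)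
      rw [accumError, ENNReal.ofReal_add (by positivity) (by positivity)]
      rw [div_eq_mul_one_div, mul_comm, ENNReal.ofReal_mul (by norm_num),
        ENNReal.ofReal_mul (by norm_num), ENNReal.ofReal_ofNat]
    simp_rw [hpt]
    rw [lintegral_add_right' _ ((hae (m + 1) (by omega) le_rfl).const_mul 2),
      lintegral_const_mul' _ _ (by simp), lintegral_const_mul' _ _ (by simp)]
    calc _ ≤ ENNReal.ofReal (1 / 4) * (3 * B) + 2 * B := by
          gcongr
          exact hB (m + 1) (by omega) le_rfl
      _ = ENNReal.ofReal (11 / 4) * B := by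
          have h3 : (3 : ENNReal) = ENNReal.ofReal 3 := by simp
          have h2 : (2 : ENNReal) = ENNReal.ofReal 2 := by simp
          rw [h3, h2, ← mul_assoc, ← ENNReal.ofReal_mul (by norm_num), ← add_mul,
            ← ENNReal.ofReal_add (by norm_num) (by norm_num)]
          norm_num
      _ ≤ 3 * B := by
          gcongr
          have h3 : (3 : ENNReal) = ENNReal.ofReal 3 := by simp
          rw [h3]
          exact ENNReal.ofReal_le_ofReal (by norm_num)

/-- The bound on the mean squared error of epoch `m`, up to the factor `(K + 1) ^ 4`: its first
term comes from the success event of the oracle, its second one, which also keeps it positive,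
from the failure event. The subtraction truncates, so that epoch `1`, which has no data, is
treated like epoch `2`. -/
noncomputable def errLevel (Err : ℕ → ℝ → ℝ) (δ : ℝ) (m : ℕ) : ℝ :=
  max (Err (2 ^ (m - 2)) δ) (Err 1 δ * δ)

/-- The parameter of the log-barrier problem in epoch `m`, for which the regularization error
`N (K + 1) ^ 4 / γ` and the estimation error `γ * errLevel` are equal. -/
noncomputable def barrierParam (N K : ℕ) (Err : ℕ → ℝ → ℝ) (δ : ℝ) (m : ℕ) : ℝ :=
  √(((K : ℝ) + 1) ^ 4 * N / errLevel Err δ m)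

section Round

variable {N K : ℕ} {X : Type*} [MeasurableSpace X] {F : Set (X → Vec N)}
  {A : OracleMap X N K} {Err : ℕ → ℝ → ℝ} {δ : ℝ}

lemma errLevel_pos (hδ : 0 < δ) (hErr : 0 < Err 1 δ) (m : ℕ) : 0 < errLevel Err δ m :=
  lt_max_of_lt_right (mul_pos hErr hδ)

lemma barrierParam_pos (hN : 1 ≤ N) (hδ : 0 < δ) (hErr : 0 < Err 1 δ) (m : ℕ) :
    0 < barrierParam N K Err δ m := by
  have := errLevel_pos hδ hErr m
  have : (0 : ℝ) < N := by exact_mod_cast hN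
  unfold barrierParam
  positivity

lemma sq_barrierParam_mul (hδ : 0 < δ) (hErr : 0 < Err 1 δ) (m : ℕ) :
    barrierParam N K Err δ m ^ 2 * errLevel Err δ m = ((K : ℝ) + 1) ^ 4 * N := by
  have := errLevel_pos hδ hErr m
  rw [barrierParam, Real.sq_sqrt (by positivity)]
  field_simp

lemma IsOfflineOracle.barrierParam_mono (hA : IsOfflineOracle F A Err)
    (hδ : δ ∈ Set.Ioo (0 : ℝ) 1) (hErr : 0 < Err 1 δ) (m : ℕ) :
    barrierParam N K Err δ m ≤ barrierParam N K Err δ (m + 1) := by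
  have h1 := errLevel_pos hδ.1 hErr (m + 1)
  refine Real.sqrt_le_sqrt (div_le_div_of_nonneg_left (by positivity) h1 ?_)
  exact max_le_max_right _ (hA.antitone δ hδ _ _ Nat.one_le_two_pow
    (Nat.pow_le_pow_right two_pos (by omega)))

lemma epochSize_succ {m : ℕ} (hm : 1 ≤ m) : epochSize (m + 1) = 2 ^ (m + 1 - 2) := by
  obtain ⟨m, rfl⟩ := Nat.exists_eq_add_of_le' hm
  simp only [epochSize, τ, Nat.add_sub_cancel, Nat.reduceSubDiff]
  have := Nat.one_le_two_pow (n := m)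
  rw [pow_succ]
  omega

lemma τ_mono : Monotone τ := fun _ _ h =>
  Nat.sub_le_sub_right (Nat.pow_le_pow_right two_pos (Nat.sub_le_sub_right h 1)) 1

lemma IsInteraction.aemeasurable_epochSamples {Ω : Type*} [MeasurableSpace Ω] {P : Measure Ω}
    {Z : ℕ → Ω → Round X N K} {D : Measure (X × Vec N)} {q : PolicyFamily X N K}
    {f : X → Vec N} {hf : Measurable f} {T : ℕ} (hZ : IsInteraction P Z D q f hf T) {t k : ℕ}
    (htT : t < T) (hk : τ k ≤ t) : AEMeasurable (epochSamples Z k) P :=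
  (measurable_epochData k t hk).comp_aemeasurable (hZ.context t htT).aemeasurable_fst

variable {Ω : Type*} {Z : ℕ → Ω → Round X N K} {D : Measure (X × Vec N)} [IsProbabilityMeasure D]
  {q : PolicyFamily X N K} {f : X → Vec N} {hf : Measurable f} {T : ℕ} {γ : ℕ → ℝ}

/-- A bound on the part of the error of the reward estimates of epoch `k`, scaled by `γ k`, that
is not controlled by the regret estimated in the previous epoch. There is no data in epoch `1`, where
the error is bounded by the diameter of the class. -/
noncomputable def estError (A : OracleMap X N K) (Err : ℕ → ℝ → ℝ) (δ : ℝ)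
    (q : PolicyFamily X N K) (f : X → Vec N) (γ : ℕ → ℝ) (Z : ℕ → Ω → Round X N K)
    (ω : Ω) (c : X × Vec N) (k : ℕ) : ℝ :=
  if k ≤ 1 then γ 1 * (K * √(256 * Err 1 δ))
  else ((K : ℝ) + 1) ^ 4 * N / 8 + 2 * γ k ^ 2 / ((K : ℝ) + 1) ^ 4 *
    sqError (fun S => (q (k - 1) (epochSamples Z (k - 1) ω, c)).real {S})
      (A _ (epochSamples Z k ω) c.1) (f c.1)

lemma sqError_nonneg {ρ : Assortment N K → ℝ} (hρ : ∀ S, 0 ≤ ρ S) (v u : Vec N) :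
    0 ≤ sqError ρ v u :=
  Finset.sum_nonneg fun S _ => mul_nonneg (hρ S) (Finset.sum_nonneg fun _ _ => sq_nonneg _)

/-- The regret of the policy of epoch `m` in a fixed context. -/
lemma IsBarrierPolicy.mul_sum_regret_le (hK : 1 ≤ K) (hN : K ≤ N)
    (hA : IsOfflineOracle F A Err) (hδ : δ ∈ Set.Ioo (0 : ℝ) 1) (hδ2 : δ < 1 / 2)
    (hErr : 0 < Err 1 δ) (hfF : f ∈ F) (hf : Measurable f)
    (hq : IsBarrierPolicy A γ q) (hγ : ∀ m, 0 < γ m) (hmono : ∀ m, 1 ≤ m → γ m ≤ γ (m + 1))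
    (Z : ℕ → Ω → Round X N K) {m : ℕ} (hm : 1 ≤ m) (ω : Ω) (c : X × Vec N) :
    γ m * ∑ S, (q m (epochSamples Z m ω, c)).real {S} *
        ((⨆ S' : Assortment N K, expReward S' (f c.1) c.2) - expReward S (f c.1) c.2) ≤
      4 / 3 * (((K : ℝ) + 1) ^ 4 * N + accumError (estError A Err δ q f γ Z ω c) m) := by
  have : Nonempty (Assortment N K) := ⟨⟨{⟨0, by omega⟩}, by simp, by simpa using hK⟩⟩
  have hopt := fun k hk => hq.optimal k hk (epochSamples Z k ω) c.1 c.2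
  have key := mul_regret_le_accumError (Rs := fun S : Assortment N K => expReward S (f c.1) c.2)
    (Rh := fun k S => expReward S (A (epochSize k) (epochSamples Z k ω) c.1) c.2)
    (c := estError A Err δ q f γ Z ω c) hγ hmono m ?_ ?_ m hm le_rfl
  · have h1 := (hopt m hm).mul_sum_regret_le hK hN (hγ m)
    set ρ := fun S => (q m (epochSamples Z m ω, c)).real {S}
    have hρ := (hopt m hm).1
    change ρ ∈ _ at hρ
    change γ m * ∑ S, ρ S * _ ≤ _ at h1
    change γ m * ∑ S, ρ S * _ ≤ _
    calc _ = ∑ S, ρ S * (γ m * ((⨆ S' : Assortment N K, expReward S' (f c.1) c.2)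
            - expReward S (f c.1) c.2)) := by
          rw [Finset.mul_sum]
          exact Finset.sum_congr rfl fun S _ => by ring
      _ ≤ ∑ S, ρ S * (4 / 3 * (γ m * ((⨆ S' : Assortment N K,
            expReward S' (A (epochSize m) (epochSamples Z m ω) c.1) c.2)
            - expReward S (A (epochSize m) (epochSamples Z m ω) c.1) c.2)
            + accumError (estError A Err δ q f γ Z ω c) m)) :=
          Finset.sum_le_sum fun S _ => mul_le_mul_of_nonneg_left (key S) (hρ.1 S)
      _ = 4 / 3 * (γ m * ∑ S, ρ S * ((⨆ S' : Assortment N K,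
            expReward S' (A (epochSize m) (epochSamples Z m ω) c.1) c.2)
            - expReward S (A (epochSize m) (epochSamples Z m ω) c.1) c.2)
            + (∑ S, ρ S) * accumError (estError A Err δ q f γ Z ω c) m) := by
          rw [Finset.mul_sum, Finset.sum_mul, ← Finset.sum_add_distrib, Finset.mul_sum]
          exact Finset.sum_congr rfl fun S _ => by ring
      _ ≤ _ := by
          rw [hρ.2, one_mul]
          gcongr
  · intro S
    simp only [estError, le_refl, if_true]
    refine mul_le_mul_of_nonneg_left ?_ (hγ 1).le
    calc _ ≤ _ := abs_expReward_sub_le S _ _ _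
      _ ≤ ∑ _i ∈ S.1, √(256 * Err 1 δ) := Finset.sum_le_sum fun i _ => Real.abs_le_sqrt
          (hA.sq_sub_le hK hδ hδ2 hErr.le hfF hf (hA.mem _ _) (hA.measurable_apply _ _) c.1 i)
      _ = S.1.card * √(256 * Err 1 δ) := by rw [Finset.sum_const, nsmul_eq_mul]
      _ ≤ _ := by
        have : (S.1.card : ℝ) ≤ K := by exact_mod_cast S.2.2
        gcongr
  · intro k hk _ S
    have hk1 : ¬ k + 1 ≤ 1 := by omega
    simp only [estError, if_neg hk1]
    exact (hopt k hk).mul_abs_expReward_sub_le hK (hγ k) _ _ (hγ (k + 1)) S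

lemma estError_nonneg (hγ : ∀ m, 0 < γ m) (ω : Ω) (c : X × Vec N) (k : ℕ) :
    0 ≤ estError A Err δ q f γ Z ω c k := by
  have := hγ 1
  have := hγ k
  have := sqError_nonneg (fun S => measureReal_nonneg
    (μ := q (k - 1) (epochSamples Z (k - 1) ω, c)) (s := {S}))
    (A _ (epochSamples Z k ω) c.1) (f c.1)
  unfold estError
  split_ifs <;> positivity

lemma measurable_estError (hA : IsOfflineOracle F A Err) (hf : Measurable f) (ω : Ω) (k : ℕ) :
    Measurable fun c => estError A Err δ q f γ Z ω c k := by
  unfold estError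
  split_ifs
  · exact measurable_const
  · exact ((measurable_sqError_right hf (hA.measurable_apply _ _) _).const_mul _).const_add _

lemma lintegral_estError (hA : IsOfflineOracle F A Err) (hf : Measurable f)
    (hq : ∀ m, IsMarkovKernel (q m)) {k : ℕ} (hk : 1 < k) (ω : Ω) :
    ∫⁻ c, ENNReal.ofReal (estError A Err δ q f γ Z ω c k) ∂D =
      ENNReal.ofReal (((K : ℝ) + 1) ^ 4 * N / 8)
        + ENNReal.ofReal (2 * γ k ^ 2 / ((K : ℝ) + 1) ^ 4) *
          designError D (q (k - 1)) (A (epochSize k)) f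
            (epochSamples Z (k - 1) ω, epochSamples Z k ω) := by
  have := hq (k - 1)
  rw [← lintegral_sqError (hA.measurable_apply _) hf, ← lintegral_const_mul' _ _ (by simp)]
  have h0 : ENNReal.ofReal (((K : ℝ) + 1) ^ 4 * N / 8) =
      ∫⁻ _c, ENNReal.ofReal (((K : ℝ) + 1) ^ 4 * N / 8) ∂D := by
    rw [lintegral_const, measure_univ, mul_one]
  rw [h0, ← lintegral_add_left measurable_const]
  refine lintegral_congr fun c => ?_
  have hs := sqError_nonneg (fun S => measureReal_nonneg
    (μ := q (k - 1) (epochSamples Z (k - 1) ω, c)) (s := {S}))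
    (A _ (epochSamples Z k ω) c.1) (f c.1)
  rw [estError, if_neg (by omega), ENNReal.ofReal_add (by positivity) (by positivity),
    ENNReal.ofReal_mul (by positivity)]

variable [MeasurableSpace Ω] {P : Measure Ω}

lemma IsInteraction.aemeasurable_lintegral_estError (hA : IsOfflineOracle F A Err)
    (hZ : IsInteraction P Z D q f hf T) (hq : ∀ m, IsMarkovKernel (q m)) {t k : ℕ}
    (htT : t < T) (hk : τ k ≤ t) :
    AEMeasurable (fun ω => ∫⁻ c, ENNReal.ofReal (estError A Err δ q f γ Z ω c k) ∂D) P := by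
  rcases le_or_gt k 1 with h | h
  · simp only [estError, if_pos h]
    exact aemeasurable_const
  · simp_rw [lintegral_estError hA hf hq h]
    have := hq (k - 1)
    refine (((measurable_designError (hA.measurable _) hf).comp_aemeasurable
      ((hZ.aemeasurable_epochSamples htT ((τ_mono (Nat.sub_le k 1)).trans hk)).prodMk
        (hZ.aemeasurable_epochSamples htT hk))).const_mul _).const_add _

variable [IsProbabilityMeasure P]

/-- The parameters `γ k` are balanced such that the expected error is of the order of
`N (K + 1) ^ 4` in all epochs. -/
lemma IsInteraction.lintegral_estError_le (hK : 1 ≤ K) (hN : K ≤ N)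
    (hA : IsOfflineOracle F A Err) (hδ : δ ∈ Set.Ioo (0 : ℝ) 1) (hδ2 : δ < 1 / 2)
    (hErr : 0 < Err 1 δ) (hfF : f ∈ F) (hZ : IsInteraction P Z D q f hf T)
    (hq : ∀ m, IsMarkovKernel (q m)) {k : ℕ} (hk : 1 ≤ k) (hkT : τ k ≤ T) :
    ∫⁻ ω, ∫⁻ c, ENNReal.ofReal
        (estError A Err δ q f (barrierParam N K Err δ) Z ω c k) ∂D ∂P ≤
      ENNReal.ofReal (529 * (((K : ℝ) + 1) ^ 4 * N)) := by
  have hlam : 0 < ((K : ℝ) + 1) ^ 4 := by positivity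
  have hK1 : (1 : ℝ) ≤ K := by exact_mod_cast hK
  have hN1 : (1 : ℝ) ≤ N := by exact_mod_cast hK.trans hN
  have hKlam : (K : ℝ) ≤ ((K : ℝ) + 1) ^ 4 := by
    calc (K : ℝ) ≤ ((K : ℝ) + 1) ^ 1 := by linarith
      _ ≤ _ := pow_le_pow_right₀ (by linarith) (by norm_num)
  rcases hk.eq_or_lt with rfl | hk
  · simp only [estError, le_refl, if_true, lintegral_const, measure_univ, mul_one]
    refine ENNReal.ofReal_le_ofReal ?_
    have h1 : errLevel Err δ 1 = Err 1 δ := by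
      simp only [errLevel]
      exact max_eq_left (mul_le_of_le_one_right hErr.le hδ.2.le)
    have h2 : barrierParam N K Err δ 1 * (K * √(256 * Err 1 δ)) =
        16 * (K * √(((K : ℝ) + 1) ^ 4 * N)) := by
      have h3 : √(256 * Err 1 δ) = 16 * √(Err 1 δ) := by
        rw [Real.sqrt_mul (by norm_num), show (256 : ℝ) = 16 ^ 2 by norm_num,
          Real.sqrt_sq (by norm_num)]
      rw [barrierParam, h1, h3, Real.sqrt_div (by positivity)]
      have : √(Err 1 δ) ≠ 0 := (Real.sqrt_pos.2 hErr).ne'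
      field_simp
    have h4 : (K : ℝ) ≤ √(((K : ℝ) + 1) ^ 4 * N) := by
      refine Real.le_sqrt_of_sq_le ?_
      calc (K : ℝ) ^ 2 ≤ ((K : ℝ) + 1) ^ 2 := by gcongr; linarith
        _ ≤ ((K : ℝ) + 1) ^ 4 := pow_le_pow_right₀ (by linarith) (by norm_num)
        _ ≤ _ := le_mul_of_one_le_right hlam.le hN1
    have h5 : √(((K : ℝ) + 1) ^ 4 * N) ^ 2 = ((K : ℝ) + 1) ^ 4 * N :=
      Real.sq_sqrt (by positivity)
    rw [h2]
    nlinarith [Real.sqrt_nonneg (((K : ℝ) + 1) ^ 4 * N)]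
  · obtain ⟨j, rfl⟩ : ∃ j, k = j + 1 := ⟨k - 1, by omega⟩
    have hj : 1 ≤ j := by omega
    simp_rw [lintegral_estError hA hf hq hk]
    have hsize := epochSize_succ hj
    have hdes := hZ.lintegral_designError_le hK hA hfF hq hδ hδ2 hErr.le (m := j)
      (by rw [hsize]; exact Nat.one_le_two_pow) hkT
    rw [lintegral_add_left measurable_const, lintegral_const, measure_univ, mul_one,
      lintegral_const_mul' _ _ (by simp)]
    refine (add_le_add_right (mul_le_mul_right hdes _) _).trans ?_
    have hpos := errLevel_pos hδ.1 hErr (j + 1)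
    have hdesr : ENNReal.ofReal (8 * ((K : ℝ) + 1) ^ 4 * Err (epochSize (j + 1)) δ)
        + ENNReal.ofReal (256 * K * Err 1 δ) * ENNReal.ofReal δ ≤
        ENNReal.ofReal (264 * ((K : ℝ) + 1) ^ 4 * errLevel Err δ (j + 1)) := by
      have e1 : Err (epochSize (j + 1)) δ ≤ errLevel Err δ (j + 1) := by
        rw [hsize]
        exact le_max_left _ _
      have e2 : Err 1 δ * δ ≤ errLevel Err δ (j + 1) := le_max_right _ _
      have e3 : 0 ≤ Err 1 δ * δ := mul_nonneg hErr.le hδ.1.le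
      rw [← ENNReal.ofReal_mul (by positivity)]
      calc _ ≤ ENNReal.ofReal (8 * ((K : ℝ) + 1) ^ 4 * errLevel Err δ (j + 1))
            + ENNReal.ofReal (256 * ((K : ℝ) + 1) ^ 4 * errLevel Err δ (j + 1)) := by
            refine add_le_add (ENNReal.ofReal_le_ofReal (by gcongr))
              (ENNReal.ofReal_le_ofReal ?_)
            calc 256 * (K : ℝ) * Err 1 δ * δ = 256 * K * (Err 1 δ * δ) := by ring
              _ ≤ _ := by gcongr
        _ = _ := by
            rw [← ENNReal.ofReal_add (by positivity) (by positivity)]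
            congr 1
            ring
    refine (add_le_add_right (mul_le_mul_right hdesr _) _).trans ?_
    rw [← ENNReal.ofReal_mul (by positivity),
      ← ENNReal.ofReal_add (by positivity) (by positivity)]
    refine ENNReal.ofReal_le_ofReal ?_
    have hsq := sq_barrierParam_mul (N := N) (K := K) hδ.1 hErr (j + 1)
    have e : 2 * barrierParam N K Err δ (j + 1) ^ 2 / ((K : ℝ) + 1) ^ 4 *
        (264 * ((K : ℝ) + 1) ^ 4 * errLevel Err δ (j + 1)) = 528 * (((K : ℝ) + 1) ^ 4 * N) := by
      rw [← hsq]
      field_simp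
      ring
    rw [e]
    have : 0 ≤ ((K : ℝ) + 1) ^ 4 * N := by positivity
    linarith

lemma measurable_regret (hf : Measurable f) :
    Measurable fun z : Round X N K =>
      (⨆ S : Assortment N K, expReward S (f z.1.1) z.1.2) - expReward z.2.1 (f z.1.1) z.1.2 := by
  have h : ∀ S : Assortment N K, Measurable fun c : X × Vec N => expReward S (f c.1) c.2 := by
    intro S
    simp only [expReward_eq_div]
    fun_prop
  have h1 : Measurable fun c : X × Vec N => ⨆ S : Assortment N K, expReward S (f c.1) c.2 :=
    Measurable.iSup h
  have h2 : Measurable fun p : (X × Vec N) × Assortment N K => expReward p.2 (f p.1.1) p.1.2 :=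
    measurable_from_prod_countable_left h
  have h3 : Measurable fun z : Round X N K => (z.1, z.2.1) := by fun_prop
  have h4 := h2.comp h3
  have h5 : Measurable fun z : Round X N K => ⨆ S : Assortment N K, expReward S (f z.1.1) z.1.2 :=
    h1.comp measurable_fst
  exact h5.sub h4

/-- The expected regret of a round of epoch `m`. -/
lemma IsInteraction.lintegral_regret_le (hK : 1 ≤ K) (hN : K ≤ N)
    (hA : IsOfflineOracle F A Err) (hδ : δ ∈ Set.Ioo (0 : ℝ) 1) (hδ2 : δ < 1 / 2)
    (hErr : 0 < Err 1 δ) (hfF : f ∈ F) (hZ : IsInteraction P Z D q f hf T)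
    (hq : IsBarrierPolicy A (barrierParam N K Err δ) q) {t m : ℕ} (htT : t < T) (hm : 1 ≤ m)
    (h : τ m ≤ t) (h' : t < τ (m + 1)) :
    ∫⁻ ω, ENNReal.ofReal ((⨆ S : Assortment N K, expReward S (f (Z t ω).1.1) (Z t ω).1.2)
        - expReward (Z t ω).2.1 (f (Z t ω).1.1) (Z t ω).1.2) ∂P ≤
      ENNReal.ofReal (2120 * √(((K : ℝ) + 1) ^ 4 * N * errLevel Err δ m)) := by
  have := hq.markov m
  set γ := barrierParam N K Err δ with hγdef
  have hγ : ∀ m, 0 < γ m := barrierParam_pos (hK.trans hN) hδ.1 hErr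
  set L := ((K : ℝ) + 1) ^ 4 * N with hL
  have hL0 : 0 ≤ L := by positivity
  rw [hZ.lintegral_round hq.markov htT h h' (φ := fun p => ENNReal.ofReal
    ((⨆ S : Assortment N K, expReward S (f p.2.1.1) p.2.1.2)
      - expReward p.2.2.1 (f p.2.1.1) p.2.1.2))
    ((measurable_regret hf).comp measurable_snd).ennreal_ofReal]
  simp only [lintegral_const, measure_univ, mul_one]
  have hpt : ∀ ω (c : X × Vec N),
      ∫⁻ S, ENNReal.ofReal ((⨆ S : Assortment N K, expReward S (f c.1) c.2)
        - expReward S (f c.1) c.2) ∂q m (epochSamples Z m ω, c) ≤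
      ENNReal.ofReal (4 / (3 * γ m)) *
        (ENNReal.ofReal L + ENNReal.ofReal (accumError (estError A Err δ q f γ Z ω c) m)) := by
    intro ω c
    have hacc := accumError_nonneg
      (estError_nonneg (A := A) (Err := Err) (δ := δ) (q := q) (f := f) (Z := Z) hγ ω c) m
    rw [← ofReal_sum_real_mul _ fun S => sub_nonneg.2 (expReward_le_iSup S _ _),
      ← ENNReal.ofReal_add hL0 hacc, ← ENNReal.ofReal_mul (by have := hγ m; positivity)]
    refine ENNReal.ofReal_le_ofReal ?_
    have key := hq.mul_sum_regret_le hK hN hA hδ hδ2 hErr hfF hf hγ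
      (fun m _ => hA.barrierParam_mono hδ hErr m) Z hm ω c
    have hγm := hγ m
    rw [← mul_le_mul_iff_right₀ hγm]
    refine key.trans (le_of_eq ?_)
    rw [← hL]
    field_simp
  calc _ ≤ ∫⁻ ω, ∫⁻ c, ENNReal.ofReal (4 / (3 * γ m)) * (ENNReal.ofReal L +
          ENNReal.ofReal (accumError (estError A Err δ q f γ Z ω c) m)) ∂D ∂P :=
        lintegral_mono fun ω => lintegral_mono fun c => hpt ω c
    _ = ENNReal.ofReal (4 / (3 * γ m)) * (ENNReal.ofReal L +
          ∫⁻ ω, ∫⁻ c, ENNReal.ofReal (accumError (estError A Err δ q f γ Z ω c) m) ∂D ∂P) := by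
        simp_rw [lintegral_const_mul' _ _ ENNReal.ofReal_ne_top,
          lintegral_add_left measurable_const, lintegral_const, measure_univ, mul_one]
    -- The resulting constant is `4 / 3 * (1 + 3 * 529) ≤ 2120`.
    _ ≤ ENNReal.ofReal (4 / (3 * γ m)) * (ENNReal.ofReal L + 3 * ENNReal.ofReal (529 * L)) := by
        gcongr
        refine lintegral_accumError_le m (estError_nonneg hγ)
          (measurable_estError hA hf) (fun k _ hk => ?_) fun k hk1 hk => ?_
        · exact hZ.aemeasurable_lintegral_estError hA hq.markov htT ((τ_mono hk).trans h)
        · exact hZ.lintegral_estError_le hK hN hA hδ hδ2 hErr hfF hq.markov hk1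
            (((τ_mono hk).trans h).trans htT.le)
    _ ≤ _ := by
        have h3 : (3 : ENNReal) = ENNReal.ofReal 3 := by simp
        have hγm := hγ m
        rw [h3, ← ENNReal.ofReal_mul (by norm_num), ← ENNReal.ofReal_add hL0 (by positivity),
          ← ENNReal.ofReal_mul (by positivity)]
        refine ENNReal.ofReal_le_ofReal ?_
        have hpos := errLevel_pos hδ.1 hErr m
        -- `L / γ = √(L * errLevel)` by the choice of `γ`.
        have e : √(L * errLevel Err δ m) = γ m * errLevel Err δ m := by
          rw [Real.sqrt_eq_iff_eq_sq (by positivity) (by positivity), mul_pow, hL,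
            ← sq_barrierParam_mul (N := N) (K := K) hδ.1 hErr m]
          ring
        have e2 : L = γ m ^ 2 * errLevel Err δ m := (sq_barrierParam_mul hδ.1 hErr m).symm
        rw [e, e2]
        have : 0 ≤ γ m * errLevel Err δ m := by positivity
        calc _ = 4 / 3 * 1588 * (γ m * errLevel Err δ m) := by
              field_simp
              ring
          _ ≤ _ := by nlinarith

end Round

/-! ### Summation over the rounds -/

/-- Round `t` belongs to epoch `Nat.log 2 (t + 1) + 1`, and epoch `j + 1` has `2 ^ j` rounds. -/
lemma sum_range_log_le (T J : ℕ) (hJ : Nat.log 2 T ≤ J) {g : ℕ → ℝ} (hg : ∀ j, 0 ≤ g j) :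
    ∑ t ∈ Finset.range T, g (Nat.log 2 (t + 1)) ≤ g 0 + ∑ j ∈ Finset.Icc 1 J, 2 ^ j * g j := by
  have hmaps : ∀ t ∈ Finset.range T, Nat.log 2 (t + 1) ∈ Finset.range (J + 1) := by
    intro t ht
    have : Nat.log 2 (t + 1) ≤ Nat.log 2 T :=
      Nat.log_mono_right (by have := Finset.mem_range.1 ht; omega)
    simp only [Finset.mem_range]
    omega
  rw [← Finset.sum_fiberwise_of_maps_to hmaps]
  have hle : ∀ j, ∑ t ∈ Finset.range T with Nat.log 2 (t + 1) = j, g (Nat.log 2 (t + 1)) ≤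
      2 ^ j * g j := by
    intro j
    rw [Finset.sum_congr rfl fun t ht => by rw [(Finset.mem_filter.1 ht).2], Finset.sum_const,
      nsmul_eq_mul]
    have hcard : ((Finset.range T).filter fun t => Nat.log 2 (t + 1) = j).card ≤ 2 ^ j := by
      have hsub : ((Finset.range T).filter fun t => Nat.log 2 (t + 1) = j) ⊆
          Finset.Ico (2 ^ j - 1) (2 ^ (j + 1) - 1) := by
        intro t ht
        have h := (Finset.mem_filter.1 ht).2
        have h1 := Nat.pow_log_le_self 2 (Nat.succ_ne_zero t)
        have h2 := Nat.lt_pow_succ_log_self one_lt_two (t + 1)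
        rw [Nat.succ_eq_add_one, h] at h1
        rw [h] at h2
        simp only [Finset.mem_Ico]
        omega
      refine (Finset.card_le_card hsub).trans ?_
      rw [Nat.card_Ico, pow_succ]
      have := Nat.one_le_two_pow (n := j)
      omega
    have hcard' : (((Finset.range T).filter fun t => Nat.log 2 (t + 1) = j).card : ℝ) ≤ 2 ^ j := by
      exact_mod_cast hcard
    exact mul_le_mul_of_nonneg_right hcard' (hg j)
  refine (Finset.sum_le_sum fun j _ => hle j).trans (le_of_eq ?_)
  have hI : Finset.Ico (0 + 1) (J + 1) = Finset.Icc 1 J := by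
    ext j
    simp only [Finset.mem_Ico, Finset.mem_Icc]
    omega
  rw [Finset.sum_range_succ', add_comm, pow_zero, one_mul, Finset.range_eq_Ico,
    Finset.sum_Ico_add' (fun j => 2 ^ j * g j) 0 J 1, hI]

lemma integral_le_of_lintegral_ofReal_le {Ω : Type*} [MeasurableSpace Ω] {P : Measure Ω}
    {g : Ω → ℝ} {b : ℝ} (hg : ∀ ω, 0 ≤ g ω) (hb : 0 ≤ b)
    (h : ∫⁻ ω, ENNReal.ofReal (g ω) ∂P ≤ ENNReal.ofReal b) : ∫ ω, g ω ∂P ≤ b := by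
  by_cases hi : Integrable g P
  · rw [integral_eq_lintegral_of_nonneg_ae (Filter.Eventually.of_forall hg)
      hi.aestronglyMeasurable]
    exact ENNReal.toReal_le_of_le_ofReal hb h
  · rwa [integral_undef hi]

section Sum

variable {N K : ℕ} {X : Type*} [MeasurableSpace X] {F : Set (X → Vec N)}
  {A : OracleMap X N K} {Err : ℕ → ℝ → ℝ} {δ : ℝ} {Ω : Type*} [MeasurableSpace Ω]
  {P : Measure Ω} [IsProbabilityMeasure P]
  {Z : ℕ → Ω → Round X N K} {D : Measure (X × Vec N)} [IsProbabilityMeasure D]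
  {q : PolicyFamily X N K} {f : X → Vec N} {hf : Measurable f} {T : ℕ}

lemma IsInteraction.regret_le_sum (hK : 1 ≤ K) (hN : K ≤ N)
    (hA : IsOfflineOracle F A Err) (hδ : δ ∈ Set.Ioo (0 : ℝ) 1) (hδ2 : δ < 1 / 2)
    (hErr : 0 < Err 1 δ) (hfF : f ∈ F) (hZ : IsInteraction P Z D q f hf T)
    (hq : IsBarrierPolicy A (barrierParam N K Err δ) q) :
    regret P Z f T ≤ ∑ t ∈ Finset.range T,
      2120 * √(((K : ℝ) + 1) ^ 4 * N * errLevel Err δ (Nat.log 2 (t + 1) + 1)) := by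
  have hnn : ∀ t ω, 0 ≤ (⨆ S : Assortment N K, expReward S (f (Z t ω).1.1) (Z t ω).1.2)
      - expReward (Z t ω).2.1 (f (Z t ω).1.1) (Z t ω).1.2 := fun t ω =>
    sub_nonneg.2 (expReward_le_iSup _ _ _)
  refine integral_le_of_lintegral_ofReal_le (fun ω => Finset.sum_nonneg fun t _ => hnn t ω)
    (Finset.sum_nonneg fun t _ => by positivity) ?_
  simp_rw [ENNReal.ofReal_sum_of_nonneg fun t _ => hnn t _]
  rw [lintegral_finsetSum', ENNReal.ofReal_sum_of_nonneg fun t _ => by positivity]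
  · refine Finset.sum_le_sum fun t ht => ?_
    have h1 := Nat.pow_log_le_self 2 (Nat.succ_ne_zero t)
    have h2 := Nat.lt_pow_succ_log_self one_lt_two (t + 1)
    refine hZ.lintegral_regret_le hK hN hA hδ hδ2 hErr hfF hq (Finset.mem_range.1 ht) (by omega)
      ?_ ?_
    · simp only [τ, Nat.add_sub_cancel, Nat.succ_eq_add_one] at *
      omega
    · simp only [τ, Nat.add_sub_cancel, Nat.succ_eq_add_one] at *
      omega
  · intro t ht
    have htT := Finset.mem_range.1 ht
    have hc : AEMeasurable (fun ω => ((past Z t ω, (Z t ω).1), (Z t ω).2)) P := by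
      have h1 := (hZ.choice t htT).aemeasurable_fst
      have h2 := (hZ.choice t htT).aemeasurable_snd
      exact (measurable_fst.comp_aemeasurable h1).prodMk
        ((measurable_snd.comp_aemeasurable h1).prodMk h2)
    have hZt : AEMeasurable (Z t) P :=
      ((measurable_snd.comp measurable_fst).prodMk measurable_snd).comp_aemeasurable hc
    exact ((measurable_regret hf).comp_aemeasurable hZt).ennreal_ofReal

end Sum

end MNLBandit

open MNLBandit in
theorem mainTheorem1 :
    ∃ C : ℝ, 0 < C ∧
    ∀ (N K T : ℕ), 1 ≤ K → K ≤ N → 2 ≤ T →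
    ∀ (Err : ℕ → ℝ → ℝ), 0 < Err 1 (1 / (T : ℝ) ^ 2) →
    ∃ γ : ℕ → ℝ, (∀ m, 0 < γ m) ∧
    ∀ (X : Type*) [MeasurableSpace X] (F : Set (X → Vec N)) (A : OracleMap X N K),
      IsOfflineOracle F A Err →
    ∀ q : PolicyFamily X N K, IsBarrierPolicy A γ q →
    ∀ (D : MeasureTheory.Measure (X × Vec N)) [MeasureTheory.IsProbabilityMeasure D]
      (f : X → Vec N) (hf : Measurable f), f ∈ F →
    ∀ (Ω : Type*) [MeasurableSpace Ω] (P : MeasureTheory.Measure Ω)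
      [MeasureTheory.IsProbabilityMeasure P] (Z : ℕ → Ω → Round X N K),
      IsInteraction P Z D q f hf T →
    regret P Z f T ≤
      C * ∑ m ∈ Finset.Icc 1 ⌈Real.logb 2 (T : ℝ)⌉₊,
        2 ^ m * (K : ℝ) ^ 2 * √((N : ℝ) * Err (2 ^ (m - 1)) (1 / (T : ℝ) ^ 2)) := by
  refine ⟨16960, by norm_num, fun N K T hK hN hT Err hErr => ?_⟩
  set δ : ℝ := 1 / (T : ℝ) ^ 2 with hδdef
  have hT2 : (2 : ℝ) ≤ T := by exact_mod_cast hT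
  have hδ0 : 0 < δ := by positivity
  have hδ4 : δ ≤ 1 / 4 := by
    rw [hδdef]
    exact one_div_le_one_div_of_le (by norm_num) (by nlinarith)
  have hδ : δ ∈ Set.Ioo (0 : ℝ) 1 := ⟨hδ0, by linarith⟩
  refine ⟨barrierParam N K Err δ, barrierParam_pos (hK.trans hN) hδ0 hErr, ?_⟩
  intro X _ F A hA q hq D _ f hf hfF Ω _ P _ Z hZ
  refine (hZ.regret_le_sum hK hN hA hδ (by linarith) hErr hfF hq).trans ?_
  have hK1 : (1 : ℝ) ≤ K := by exact_mod_cast hK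
  set g : ℕ → ℝ := fun j => √((N : ℝ) * Err (2 ^ (j - 1)) δ) with hg
  have hg0 : ∀ j, 0 ≤ g j := fun j => Real.sqrt_nonneg _
  -- The failure probability contributes `√(N * Err 1 δ) / T` to each of the `T` rounds.
  have hround : ∀ j, 2120 * √(((K : ℝ) + 1) ^ 4 * N * errLevel Err δ (j + 1)) ≤
      8480 * (K : ℝ) ^ 2 * (g j + g 0 / T) := by
    intro j
    have h1 : √((N : ℝ) * errLevel Err δ (j + 1)) ≤ g j + g 0 / T := by
      have e : g 0 / T = √((N : ℝ) * (Err 1 δ * δ)) := by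
        have hsδ : √δ = 1 / T := by
          rw [hδdef, Real.sqrt_div' _ (by positivity), Real.sqrt_one,
            Real.sqrt_sq (by positivity)]
        rw [← mul_assoc, Real.sqrt_mul' _ hδ0.le, hsδ, mul_one_div]
        rfl
      rw [e]
      rcases max_choice (Err (2 ^ (j + 1 - 2)) δ) (Err 1 δ * δ) with h | h
      · rw [errLevel, h]
        exact le_add_of_nonneg_right (Real.sqrt_nonneg _)
      · rw [errLevel, h]
        exact le_add_of_nonneg_left (hg0 j)
    have h2 : √(((K : ℝ) + 1) ^ 4 * N * errLevel Err δ (j + 1)) =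
        ((K : ℝ) + 1) ^ 2 * √((N : ℝ) * errLevel Err δ (j + 1)) := by
      rw [mul_assoc, Real.sqrt_mul (by positivity), show ((K : ℝ) + 1) ^ 4 =
        (((K : ℝ) + 1) ^ 2) ^ 2 by ring, Real.sqrt_sq (by positivity)]
    have h3 : ((K : ℝ) + 1) ^ 2 ≤ 4 * (K : ℝ) ^ 2 := by nlinarith
    rw [h2]
    calc 2120 * (((K : ℝ) + 1) ^ 2 * √((N : ℝ) * errLevel Err δ (j + 1)))
        ≤ 2120 * (4 * (K : ℝ) ^ 2 * (g j + g 0 / T)) := by gcongr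
      _ = _ := by ring
  set J := ⌈Real.logb 2 (T : ℝ)⌉₊ with hJdef
  have hJ : Nat.log 2 T ≤ J := by
    have h1 : ((Nat.log 2 T : ℕ) : ℝ) ≤ Real.logb 2 T := by
      rw [Real.le_logb_iff_rpow_le one_lt_two (by positivity), Real.rpow_natCast]
      exact_mod_cast Nat.pow_log_le_self 2 (by omega)
    exact Nat.cast_le.1 (h1.trans (Nat.le_ceil _))
  have hJ1 : 1 ≤ J := (Nat.log_pos one_lt_two hT).trans_le hJ
  have hfirst : 2 * g 0 ≤ ∑ j ∈ Finset.Icc 1 J, 2 ^ j * g j := by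
    have := Finset.single_le_sum (f := fun j => 2 ^ j * g j) (s := Finset.Icc 1 J)
      (fun j _ => mul_nonneg (by positivity) (hg0 j)) (Finset.mem_Icc.2 ⟨le_rfl, hJ1⟩)
    simpa [hg] using this
  calc ∑ t ∈ Finset.range T,
        2120 * √(((K : ℝ) + 1) ^ 4 * N * errLevel Err δ (Nat.log 2 (t + 1) + 1))
      ≤ ∑ t ∈ Finset.range T, 8480 * (K : ℝ) ^ 2 * (g (Nat.log 2 (t + 1)) + g 0 / T) :=
        Finset.sum_le_sum fun t _ => hround _
    _ = 8480 * (K : ℝ) ^ 2 * (∑ t ∈ Finset.range T, g (Nat.log 2 (t + 1)) + g 0) := by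
        rw [← Finset.mul_sum, Finset.sum_add_distrib, Finset.sum_const, Finset.card_range,
          nsmul_eq_mul, mul_div_cancel₀ _ (by positivity)]
    _ ≤ 8480 * (K : ℝ) ^ 2 * (2 * ∑ j ∈ Finset.Icc 1 J, 2 ^ j * g j) := by
        have := sum_range_log_le T J hJ hg0
        gcongr
        linarith
    _ = 16960 * ∑ m ∈ Finset.Icc 1 J, 2 ^ m * (K : ℝ) ^ 2 * g m := by
        simp only [Finset.mul_sum]
        exact Finset.sum_congr rfl fun m _ => by ring
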